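/- **Theorem (Dimension estimates for the realization space of the 24-cell).** Let $C=C_4^{(24)}\subset\mathbb R^4$ be the regular 24-cell, the convex hull of the 24 points $\pm e_i\pm e_j$, $1\le i<j\le 4$. Label the columns of pairs of matrices $(V,A)\in\mathbb R^{4\times 24}\times\mathbb R^{4\times 24}=\mathbb R^{192}$ by the 24 vertices $v$ of $C$ (columns $V_v$ of $V$) and the 24 facets $F$ of $C$ (columns $A_F$ of $A$). The *centered realization space* $\mathcal R_C\subset\mathbb R^{192}$ is the set of all $(V,A)$ such that $Q:=\operatorname{conv}\{V_v\}=\{y\in\mathbb R^4 : A^t y\le \mathbf 1\}$ and such that there is an isomorphism from the face lattice of $C$ to the face lattice of $Q$ that maps each vertex $v$ to the vertex $V_v$ and each facet $F$ to the facet $\{y\in Q: A_F^t y=1\}$. Its dimension $\dim\mathcal R_C$ is its dimension as a semialgebraic set, i.e. the Krull dimension of $\mathbb R[X_1,\dots,X_{192}]/I(\mathcal R_C)$, where $I(\mathcal R_C)$ is the ideal of polynomials vanishing on $\mathcal R_C$. Let $\Phi$ be the map $(V,A)\mapsto (V_v^tA_F-1)_{v\in F}$, with one component for each vertex-facet incidence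 of $C$, and let $J(V,A)$ be its Jacobian matrix. Then: 1. $48\le\dim \mathcal R_C\le 52$. 2. There are $144$ vertex-facet incidences, so $J$ is a $144\times 192$ matrix, and there is a point of $\mathcal R_C$ at which $J$ has full rank $144$. 3. There are vertices $v,u$ of $C$ that form an edge, facets $F,G$ of $C$ that contain this edge and meet in a ridge, and a linear ordering of the 48 vertices and facets of $C$ such that * $v,u,F,G$ come first; * every facet $H\ne F,G$ is preceded by two of its vertices that form an edge, and every vertex $w\neq v,u$ is preceded by two facets that contain $w$ and meet in a ridge; * after deletion of the four incidences between $\{v,u\}$ and $\{F,G\}$, every vertex (facet) has at most $4$ incident facets (vertices) that come after it in the ordering; * the submatrix of $J$ formed by the $140$ rows of the remaining incidences has full rank $140$ at every point of $\mathcal R_C$. -/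

import Mathlib

/-- The faces of a polytope `P`, including `∅` and `P` itself: the subsets of `P` on which some
linear functional attains its maximum over `P` (and `∅`). Ordered by inclusion, they form the
face lattice of `P`. -/
abbrev Face {d : ℕ} (P : Set (Fin d → ℝ)) : Type := {S : Set (Fin d → ℝ) // IsExposed ℝ P S}

/-- The dimension of the affine hull of a nonempty set `S`. -/
noncomputable def affDim {d : ℕ} (S : Set (Fin d → ℝ)) : ℕ := Module.finrank ℝ (vectorSpan ℝ S)

/-- The vertices of `P`: the points that form a face of dimension `0`. -/
def Vertex {d : ℕ} (P : Set (Fin d → ℝ)) : Type := {v : Fin d → ℝ // IsExposed ℝ P {v}}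

/-- The facets of a `d`-polytope `P`: the faces of dimension `d - 1`. -/
def Facet {d : ℕ} (P : Set (Fin d → ℝ)) : Type :=
  {F : Face P // F.1.Nonempty ∧ affDim F.1 + 1 = d}

/-- A vertex as an element of the face lattice. -/
def Vertex.face {d : ℕ} {P : Set (Fin d → ℝ)} (v : Vertex P) : Face P := ⟨{v.1}, v.2⟩

/-- A facet as a set of points. -/
def Facet.pts {d : ℕ} {P : Set (Fin d → ℝ)} (F : Facet P) : Set (Fin d → ℝ) := F.1.1

/-- The nodes of the vertex-facet incidence graph of `P`. -/
abbrev Node {d : ℕ} (P : Set (Fin d → ℝ)) : Type := Vertex P ⊕ Facet P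

/-- The edges of the vertex-facet incidence graph of `P`: the pairs `(v, F)` with `v ∈ F`. -/
def Incidence {d : ℕ} (P : Set (Fin d → ℝ)) : Type :=
  {e : Vertex P × Facet P // e.1.1 ∈ e.2.pts}

/-- The vertex of an incidence. -/
def Incidence.vertex {d : ℕ} {P : Set (Fin d → ℝ)} (e : Incidence P) : Vertex P := e.1.1

/-- The facet of an incidence. -/
def Incidence.facet {d : ℕ} {P : Set (Fin d → ℝ)} (e : Incidence P) : Facet P := e.1.2

/-- The index set of the coordinates of a pair of matrices `(V, A)` in `ℝ ^ (d × (n + m))`, whose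
columns are labeled by the `n` vertices and the `m` facets of `P`. -/
abbrev Coord {d : ℕ} (P : Set (Fin d → ℝ)) : Type := Node P × Fin d

/-- The column of `V` labeled by the vertex `v`, for `x = (V, A)`. -/
def vcol {d : ℕ} {P : Set (Fin d → ℝ)} (x : Coord P → ℝ) (v : Vertex P) : Fin d → ℝ :=
  fun k => x (Sum.inl v, k)

/-- The column of `A` labeled by the facet `F`, for `x = (V, A)`. -/
def acol {d : ℕ} {P : Set (Fin d → ℝ)} (x : Coord P → ℝ) (F : Facet P) : Fin d → ℝ :=
  fun k => x (Sum.inr F, k)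

/-- The centered realization space of the polytope `P`: the pairs of matrices `(V, A)` for which
the convex hull of the columns of `V` equals `{y | Aᵗ y ≤ 1}` and realizes `P`, that is, there is
an isomorphism of face lattices from `P` to this polytope that respects the labels: it
takes each vertex `v` of `P` to the vertex which is the column of `V` labeled `v`, and each facet
`F` of `P` to the facet which is cut out by the column of `A` labeled `F`. -/
def centeredRealizationSpace {d : ℕ} (P : Set (Fin d → ℝ)) : Set (Coord P → ℝ) :=
  {x | convexHull ℝ (Set.range (vcol x)) = {y | ∀ F : Facet P, acol x F ⬝ᵥ y ≤ 1} ∧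
    ∃ φ : Face P ≃o Face (convexHull ℝ (Set.range (vcol x))),
      (∀ v : Vertex P, (φ v.face).1 = {vcol x v}) ∧
      (∀ F : Facet P,
        (φ F.1).1 = {y ∈ convexHull ℝ (Set.range (vcol x)) | acol x F ⬝ᵥ y = 1})}

/-- The dimension of a (semialgebraic) set `S ⊆ ℝ ^ σ`: the Krull dimension of the ring
`ℝ[X] / I(S)` of polynomial functions on `S`. -/
noncomputable def semialgebraicDim {σ : Type} (S : Set (σ → ℝ)) : WithBot ℕ∞ :=
  ringKrullDim (MvPolynomial σ ℝ ⧸ MvPolynomial.vanishingIdeal ℝ S)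

/-- The characteristic map of `P`, `(V, A) ↦ (v ⬝ a_F - 1)`, with one component for every
vertex-facet incidence, as a family of polynomials in the entries of `(V, A)`. -/
noncomputable def charMap {d : ℕ} (P : Set (Fin d → ℝ)) (e : Incidence P) :
    MvPolynomial (Coord P) ℝ :=
  ∑ k : Fin d, MvPolynomial.X (Sum.inl e.vertex, k) * MvPolynomial.X (Sum.inr e.facet, k) - 1

/-- The Jacobian matrix of the characteristic map of `P` at `x = (V, A)`. -/
noncomputable def jacobian {d : ℕ} (P : Set (Fin d → ℝ)) (x : Coord P → ℝ) :
    Matrix (Incidence P) (Coord P) ℝ :=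
  fun e c => MvPolynomial.eval x (MvPolynomial.pderiv c (charMap P e))

/-- The distinct vertices `v` and `w` form an edge of `P`. -/
def FormEdge {d : ℕ} {P : Set (Fin d → ℝ)} (v w : Vertex P) : Prop :=
  v ≠ w ∧ ∃ e : Face P, affDim e.1 = 1 ∧ v.1 ∈ e.1 ∧ w.1 ∈ e.1

/-- The distinct facets `F` and `G` of `P` meet in a ridge, a face of dimension `d - 2`. -/
def FormRidge {d : ℕ} {P : Set (Fin d → ℝ)} (F G : Facet P) : Prop :=
  F ≠ G ∧ (F.pts ∩ G.pts).Nonempty ∧ affDim (F.pts ∩ G.pts) + 2 = d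

/-- The incidences that remain when those between `{v, u}` and `{F, G}` are deleted. -/
def remaining {d : ℕ} {P : Set (Fin d → ℝ)} (v u : Vertex P) (F G : Facet P) :
    Set (Incidence P) :=
  {e | ¬ ((e.vertex = v ∨ e.vertex = u) ∧ (e.facet = F ∨ e.facet = G))}

/-- The ordering of the nodes of the incidence graph of `P` by increasing value of `pos` starts
with the vertices `v, u` of an edge and two facets `F, G` that contain it and meet in a ridge;
it adds a facet only after two vertices that form an edge of it, and a vertex only after two
facets that meet in a ridge containing it; and it is `k`-degenerate once the incidences between
`{v, u}` and `{F, G}` are deleted: every node has at most `k` later neighbours. -/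
structure IsNearDegenerateOrdering {d : ℕ} {P : Set (Fin d → ℝ)} (k : ℕ) (pos : Node P → ℕ)
    (v u : Vertex P) (F G : Facet P) : Prop where
  injective : Function.Injective pos
  edge : FormEdge v u
  ridge : FormRidge F G
  mem : v.1 ∈ F.pts ∩ G.pts ∧ u.1 ∈ F.pts ∩ G.pts
  start : ∀ a ∈ ({Sum.inl v, Sum.inl u, Sum.inr F, Sum.inr G} : Set (Node P)),
    ∀ b ∉ ({Sum.inl v, Sum.inl u, Sum.inr F, Sum.inr G} : Set (Node P)), pos a < pos b
  add_facet : ∀ H : Facet P, H ≠ F → H ≠ G → ∃ p q : Vertex P, FormEdge p q ∧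
    p.1 ∈ H.pts ∧ q.1 ∈ H.pts ∧ pos (Sum.inl p) < pos (Sum.inr H) ∧
    pos (Sum.inl q) < pos (Sum.inr H)
  add_vertex : ∀ w : Vertex P, w ≠ v → w ≠ u → ∃ H K : Facet P, FormRidge H K ∧
    w.1 ∈ H.pts ∧ w.1 ∈ K.pts ∧ pos (Sum.inr H) < pos (Sum.inl w) ∧
    pos (Sum.inr K) < pos (Sum.inl w)
  later_facets : ∀ w : Vertex P, {e ∈ remaining v u F G |
    e.vertex = w ∧ pos (Sum.inl w) < pos (Sum.inr e.facet)}.encard ≤ k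
  later_vertices : ∀ H : Facet P, {e ∈ remaining v u F G |
    e.facet = H ∧ pos (Sum.inr H) < pos (Sum.inl e.vertex)}.encard ≤ k

/-- The regular 24-cell, the convex hull of the 24 points `± e i ± e j` with `i < j`. -/
def cell24 : Set (Fin 4 → ℝ) :=
  convexHull ℝ {x | ∃ i j : Fin 4, i < j ∧ ∃ s t : ℝ, (s = 1 ∨ s = -1) ∧ (t = 1 ∨ t = -1) ∧
    x = Pi.single i s + Pi.single j t}

open scoped TensorProduct
open Filter Topology

/-! A linear dependence among rows of `J` at `(V, A)` is a stress: numbers `C v F`, zero off the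
chosen incidences, with `∑ F, C v F • A F = 0` for every `v` and `∑ v, C v F • V v = 0` for every
`F`. Suppose that all facets `G ≠ F` with `C v G ≠ 0` contain a vertex `w` that `F` misses. Pairing
the first relation with `V v - V w` leaves `C v F * (1 - A F ⬝ᵥ V w) = 0`, so `C v F = 0`
(`eq_zero_of_sum_smul_eq_zero`); the dual argument exchanges vertices and facets. Only incidences
enter, so this works at every realization. In the chosen ordering each node in turn kills its
incidences with later neighbours, and once the four deleted incidences carry no stress, no other
does (`eq_zero_of_checkSteps`). Hence the 140 rows are independent everywhere, and the Jacobian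
criterion gives dimension at most 192 - 140 = 52 (`semialgebraicDim_le`).

For the lower bound, a point is needed where stresses vanish on the four deleted incidences as well.
It is the member `a = 1/2` of a one-parameter family through the regular 24-cell. Four infinitesimal
deformations of it preserve all other incidence equations to first order and change the four deleted
ones by an invertible matrix; a stress annihilates such changes, so it vanishes there
(`eq_zero_of_deleted`). Near this point the incidence equations alone describe the realization space
(`Realizes.eventually`), so a linear map sends the space onto a neighbourhood in dimension 192 - 144
= 48 and yields 48 algebraically independent functions (`le_semialgebraicDim_of_eventually`).

Both halves work with incidences instead of face lattices. This is justified by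
`mem_centeredRealizationSpace_iff`: a face is cut out by the facets through its vertices, so
incidences determine the lattice. -/

/-! ### Krull dimension and the Jacobian criterion -/

theorem ringKrullDim_le_of_algebra_isIntegral (R S : Type*) [CommRing R] [CommRing S] [Algebra R S]
    [Algebra.IsIntegral R S] : ringKrullDim S ≤ ringKrullDim R :=
  Order.krullDim_le_of_strictMono (PrimeSpectrum.comap (algebraMap R S)) fun p q hpq =>
    Ideal.IsIntegral.comap_lt_comap (R := R) (I := p.asIdeal) (J := q.asIdeal) hpq

/-- Lying over starts a lift of each chain of primes, and going up continues it. -/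
theorem ringKrullDim_le_of_algebra_isIntegral_of_injective (R S : Type*) [CommRing R] [IsDomain R]
    [CommRing S] [IsDomain S] [Algebra R S] [Algebra.IsIntegral R S]
    (h : Function.Injective (algebraMap R S)) : ringKrullDim R ≤ ringKrullDim S := by
  refine iSup_le fun l => ?_
  have : (⊥ : Ideal S).LiesOver (⊥ : Ideal R) :=
    ⟨((RingHom.injective_iff_ker_eq_bot _).mp h).symm⟩
  obtain ⟨Q, -, hQ, hQl⟩ := Ideal.exists_ideal_ge_liesOver_of_le (p := ⊥)
    (q := (RelSeries.head l).asIdeal) (⊥ : Ideal S) bot_le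
  obtain ⟨L, hL, -⟩ := Ideal.exists_ltSeries_of_hasGoingUp l Q
  rw [← hL]
  exact Order.LTSeries.length_le_krullDim L

/-- Every chain of primes lies above some minimal prime, so it survives in that quotient. -/
theorem ringKrullDim_le_of_forall_minimalPrimes {R : Type*} [CommRing R] {n : WithBot ℕ∞}
    (h : ∀ p ∈ minimalPrimes R, ringKrullDim (R ⧸ p) ≤ n) : ringKrullDim R ≤ n := by
  refine iSup_le fun l => ?_
  obtain ⟨p, hp, hpl⟩ := Ideal.exists_minimalPrimes_le (J := l.head.asIdeal) bot_le
  refine le_trans ?_ (h p hp)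
  rw [ringKrullDim_quotient]
  exact Order.LTSeries.length_le_krullDim (⟨l.length, fun i => ⟨l i, fun x hx =>
    l.head_le i (hpl hx)⟩, fun i => l.step i⟩ : LTSeries (PrimeSpectrum.zeroLocus (p : Set R)))

/-- A finitely generated algebra over a field that contains a polynomial ring in `n` variables has
Krull dimension at least `n`. -/
theorem le_ringKrullDim_of_injective_mvPolynomial {k A : Type*} [Field k] [CommRing A]
    [Algebra k A] [Algebra.FiniteType k A] {n : ℕ} (f : MvPolynomial (Fin n) k →ₐ[k] A)
    (hf : Function.Injective f) : (n : WithBot ℕ∞) ≤ ringKrullDim A := by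
  -- A prime `P` that contracts to zero keeps the map to `A ⧸ P` injective. This reduces to a
  -- domain, where Noether normalization compares `n` with the transcendence degree `s`.
  obtain ⟨P, hP, hPf⟩ := Ideal.exists_comap_eq_of_mem_minimalPrimes_of_injective
    (f := f.toRingHom) hf ⊥ (by simp [IsDomain.minimalPrimes_eq_singleton_bot])
  refine le_trans ?_ (ringKrullDim_quotient_le P)
  obtain ⟨s, g, hg, hgi⟩ := exists_integral_inj_algHom_of_fg k (A ⧸ P)
  have hn : n ≤ s := by
    let q := (Ideal.Quotient.mkₐ k P).comp f
    have hq : Function.Injective q := by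
      rw [injective_iff_map_eq_zero]
      intro x hx
      have h : x ∈ P.comap f.toRingHom := (Ideal.Quotient.eq_zero_iff_mem (I := P)).mp hx
      rwa [hPf] at h
    have hind : AlgebraicIndependent k (fun i => q (MvPolynomial.X i)) := by
      have : MvPolynomial.aeval (fun i => q (MvPolynomial.X i)) = q := by
        ext; simp
      rw [AlgebraicIndependent, this]; exact hq
    have h1 := hind.lift_cardinalMk_le_trdeg
    algebraize [g.toRingHom]
    have : Algebra.IsIntegral (MvPolynomial (Fin s) k) (A ⧸ P) := ⟨hgi⟩
    have : IsScalarTower k (MvPolynomial (Fin s) k) (A ⧸ P) := IsScalarTower.of_algebraMap_eq fun x => (g.commutes x).symm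
    have : FaithfulSMul (MvPolynomial (Fin s) k) (A ⧸ P) :=
      (faithfulSMul_iff_algebraMap_injective _ _).mpr hg
    have h2 := lift_trdeg_add_eq k (MvPolynomial (Fin s) k) (A ⧸ P)
    rw [MvPolynomial.trdeg_of_isDomain, trdeg_eq_zero] at h2
    simp at h1 h2
    rw [← h2] at h1
    simpa using h1
  let := g.toRingHom.toAlgebra
  have : Algebra.IsIntegral (MvPolynomial (Fin s) k) (A ⧸ P) := ⟨hgi⟩
  refine le_trans ?_ (ringKrullDim_le_of_algebra_isIntegral_of_injective
    (MvPolynomial (Fin s) k) (A ⧸ P) hg)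
  simpa using hn

/-- If a domain is integral over a polynomial ring in `s` variables over a field of characteristic
zero, then the Kähler differentials of its field of fractions have dimension `s`. -/
theorem finrank_kaehlerDifferential_of_integral_mvPolynomial {k B K : Type} [Field k] [CharZero k]
    [CommRing B] [IsDomain B] [Algebra k B] [Field K] [Algebra B K] [IsFractionRing B K]
    [Algebra k K] [IsScalarTower k B K]
    {s : ℕ} (g : MvPolynomial (Fin s) k →ₐ[k] B) (hg : Function.Injective g)
    (hgi : g.IsIntegral) : Module.finrank K (Ω[K⁄k]) = s := by
  let R := MvPolynomial (Fin s) k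
  let _ : Algebra R B := g.toRingHom.toAlgebra
  have : Algebra.IsIntegral R B := ⟨hgi⟩
  have : IsScalarTower k R B := IsScalarTower.of_algebraMap_eq fun x => (g.commutes x).symm
  let _ : Algebra R K := ((algebraMap B K).comp g.toRingHom).toAlgebra
  have : IsScalarTower R B K := IsScalarTower.of_algebraMap_eq fun x => rfl
  have : IsScalarTower k R K := IsScalarTower.of_algebraMap_eq fun x => by
    rw [IsScalarTower.algebraMap_apply R B K, ← IsScalarTower.algebraMap_apply k R B,
      ← IsScalarTower.algebraMap_apply k B K]
  have : FaithfulSMul R K := (faithfulSMul_iff_algebraMap_injective _ _).mpr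
    ((IsFractionRing.injective B K).comp hg)
  let F := FractionRing R
  let _ : Algebra F K := FractionRing.liftAlgebra R K
  have : IsScalarTower R F K := FractionRing.isScalarTower_liftAlgebra R K
  have : Algebra.IsAlgebraic B K := IsLocalization.isAlgebraic K (nonZeroDivisors B)
  have : NoZeroDivisors B := inferInstance
  have : Algebra.IsAlgebraic R K := Algebra.IsAlgebraic.trans R B K
  have : Algebra.IsAlgebraic F K :=
    (IsFractionRing.comap_isAlgebraic_iff (A := R) (K := F) (C := K)).mp inferInstance
  have : CharZero R := inferInstance
  have : CharZero F := inferInstance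
  -- Characteristic zero makes `K` separable over `F`. So `K` is formally étale over the polynomial
  -- ring, and its differentials are the base change of a free module of rank `s`.
  have : Algebra.FormallyEtale F K := Algebra.FormallyEtale.of_isSeparable F K
  have : Algebra.FormallyEtale R F := Algebra.FormallyEtale.of_isLocalization (nonZeroDivisors R)
  have : Algebra.FormallyEtale R K := Algebra.FormallyEtale.comp R F K
  rw [← (KaehlerDifferential.tensorKaehlerEquivOfFormallyEtale k R K).finrank_eq,
    Module.finrank_eq_card_basis ((KaehlerDifferential.mvPolynomialBasis k (Fin s)).baseChange K)]
  simp

theorem KaehlerDifferential.D_aeval {k K σ : Type*} [CommRing k] [CommRing K] [Algebra k K]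
    [Fintype σ] (x : σ → K) (f : MvPolynomial σ k) :
    KaehlerDifferential.D k K (MvPolynomial.aeval x f) =
      ∑ j, MvPolynomial.aeval x (MvPolynomial.pderiv j f) • KaehlerDifferential.D k K (x j) := by
  classical
  induction f using MvPolynomial.induction_on with
  | C a => simp
  | add p q hp hq => simp [hp, hq, add_smul, Finset.sum_add_distrib]
  | mul_X p i hp =>
    simp [hp, add_smul, Finset.sum_add_distrib, Finset.smul_sum, mul_smul, Pi.single_apply,
      apply_ite (MvPolynomial.aeval x)]

/-- The Jacobian criterion: the dimension of an affine domain is at most the number of variables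
minus the generic rank of the Jacobian matrix of some of its relations. -/
theorem ringKrullDim_le_of_linearIndependent_pderiv {k B K σ ι : Type} [Field k] [CharZero k]
    [CommRing B] [IsDomain B] [Algebra k B] [Field K] [Algebra B K] [IsFractionRing B K]
    [Algebra k K] [IsScalarTower k B K] [Fintype σ] [Fintype ι]
    (φ : MvPolynomial σ k →ₐ[k] B) (hφ : Function.Surjective φ)
    (f : ι → MvPolynomial σ k) (hf : ∀ i, φ (f i) = 0)
    (hind : LinearIndependent K
      (fun i j => algebraMap B K (φ (MvPolynomial.pderiv j (f i))) : ι → σ → K)) :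
    ringKrullDim B ≤ (Fintype.card σ - Fintype.card ι : ℕ) := by
  have : Algebra.FiniteType k B := Algebra.FiniteType.of_surjective φ hφ
  obtain ⟨s, g, hg, hgi⟩ := exists_integral_inj_algHom_of_fg k B
  have hs := finrank_kaehlerDifferential_of_integral_mvPolynomial (K := K) g hg hgi
  have h1 : ringKrullDim B ≤ (s : ℕ) := by
    let _ := g.toRingHom.toAlgebra
    have : Algebra.IsIntegral (MvPolynomial (Fin s) k) B := ⟨hgi⟩
    simpa using ringKrullDim_le_of_algebra_isIntegral (MvPolynomial (Fin s) k) B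
  refine h1.trans ?_
  let x : σ → K := fun j => algebraMap B K (φ (MvPolynomial.X j))
  have hx : ∀ p, MvPolynomial.aeval x p = algebraMap B K (φ p) := fun p => by
    have : MvPolynomial.aeval x = (IsScalarTower.toAlgHom k B K).comp φ := by
      ext j; simp [x]
    rw [this]; rfl
  -- `d` sends the unit vector at `j` to the differential of `x j`. It is onto a space of dimension
  -- `s`, and by the chain rule its kernel contains the gradients of the relations.
  let d : (σ → K) →ₗ[K] Ω[K⁄k] := Fintype.linearCombination K (fun j => KaehlerDifferential.D k K (x j))
  have hd : Function.Surjective d := by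
    rw [← LinearMap.range_eq_top, eq_top_iff,
      ← KaehlerDifferential.span_range_map_derivation_of_isLocalization k B K (nonZeroDivisors B),
      Submodule.span_le]
    rintro _ ⟨b, rfl⟩
    obtain ⟨p, rfl⟩ := hφ b
    refine ⟨fun j => MvPolynomial.aeval x (MvPolynomial.pderiv j p), ?_⟩
    simp only [d, Fintype.linearCombination_apply]
    rw [← KaehlerDifferential.D_aeval, hx]
    simp
  have hker : Fintype.card ι ≤ Module.finrank K (LinearMap.ker d) := by
    have hmem : ∀ i, (fun j => algebraMap B K (φ (MvPolynomial.pderiv j (f i))) : σ → K) ∈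
        LinearMap.ker d := fun i => by
      simp only [LinearMap.mem_ker, d, Fintype.linearCombination_apply, ← hx]
      rw [← KaehlerDifferential.D_aeval, hx, hf, map_zero, map_zero]
    have : LinearIndependent K (fun i => (⟨_, hmem i⟩ : LinearMap.ker d)) :=
      LinearIndependent.of_comp (LinearMap.ker d).subtype hind
    exact this.fintype_card_le_finrank
  have h2 := LinearMap.finrank_range_add_finrank_ker d
  rw [LinearMap.range_eq_top.mpr hd, finrank_top, hs, Module.finrank_fintype_fun_eq_card] at h2
  have : s ≤ Fintype.card σ - Fintype.card ι := by omega
  exact_mod_cast this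

/-! ### Dimension of real sets cut out by polynomials -/

/-- A minimal prime over the vanishing ideal of `S` contains every polynomial that vanishes on the
part of `S` in its zero locus. -/
theorem mem_of_mem_minimalPrimes_vanishingIdeal {σ : Type} [Finite σ] {S : Set (σ → ℝ)}
    {P : Ideal (MvPolynomial σ ℝ)} (hP : P ∈ (MvPolynomial.vanishingIdeal ℝ S).minimalPrimes)
    {h : MvPolynomial σ ℝ}
    (hh : ∀ x ∈ S, (∀ p ∈ P, MvPolynomial.eval x p = 0) → MvPolynomial.eval x h = 0) : h ∈ P := by
  classical
  by_contra hhP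
  have hPprime : P.IsPrime := hP.1.1
  let I := MvPolynomial.vanishingIdeal ℝ S
  have hfin : I.minimalPrimes.Finite := Ideal.finite_minimalPrimes_of_isNoetherianRing _ I
  -- Every other minimal prime `Q` contributes an element outside `P`; for `Q ≤ P`, in particular
  -- for `P` itself, 1 is a harmless filler. At a point of `S` some minimal prime vanishes: if it is
  -- `P`, then `h` vanishes, and otherwise the factor from `Q` does. So the product lies in the
  -- ideal although no factor lies in `P`.
  have hq : ∀ Q : Ideal (MvPolynomial σ ℝ), ∃ q, q ∉ P ∧ (Q ∈ I.minimalPrimes → Q ≠ P → q ∈ Q) := by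
    intro Q
    by_cases hQ : Q ≤ P
    · refine ⟨1, fun h1 => hPprime.ne_top ((Ideal.eq_top_iff_one _).mpr h1), fun hQm hne => ?_⟩
      exact absurd (le_antisymm hQ (hP.2 hQm.1 hQ)) hne
    · obtain ⟨q, hqQ, hqP⟩ := Set.not_subset.mp hQ
      exact ⟨q, hqP, fun _ _ => hqQ⟩
  choose q hqP hqQ using hq
  have hprod : h * ∏ Q ∈ hfin.toFinset, q Q ∈ I := by
    rw [MvPolynomial.mem_vanishingIdeal_iff]
    intro x hx
    obtain ⟨Q, hQm, hQx⟩ := Ideal.exists_minimalPrimes_le (I := I)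
      (J := MvPolynomial.vanishingIdeal ℝ {x})
      (MvPolynomial.vanishingIdeal_anti_mono (by simpa using hx))
    have hQx' : ∀ p ∈ Q, MvPolynomial.aeval x p = 0 := fun p hp =>
      (MvPolynomial.mem_vanishingIdeal_singleton_iff x p).mp (hQx hp)
    rw [map_mul, map_prod]
    by_cases hQP : Q = P
    · subst hQP
      have := hh x hx (fun p hp => by simpa [MvPolynomial.aeval_eq_eval] using hQx' p hp)
      rw [MvPolynomial.aeval_eq_eval]
      simp [this]
    · rw [Finset.prod_eq_zero (hfin.mem_toFinset.mpr hQm) (hQx' _ (hqQ Q hQm hQP)), mul_zero]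
  rcases hPprime.mem_or_mem (hP.1.2 hprod) with h1 | h1
  · exact hhP h1
  · obtain ⟨Q, -, hQ⟩ := (hPprime.prod_mem_iff).mp h1
    exact hqP Q hQ

/-- The dimension of a set on which some polynomials vanish whose Jacobian matrix has full rank at
every point of the set. -/
theorem semialgebraicDim_le {σ ι : Type} [Fintype σ] [Fintype ι] (S : Set (σ → ℝ))
    (f : ι → MvPolynomial σ ℝ) (hf : ∀ x ∈ S, ∀ i, MvPolynomial.eval x (f i) = 0)
    (hind : ∀ x ∈ S, LinearIndependent ℝ
      (fun i j => MvPolynomial.eval x (MvPolynomial.pderiv j (f i)) : ι → σ → ℝ)) :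
    semialgebraicDim S ≤ (Fintype.card σ - Fintype.card ι : ℕ) := by
  classical
  let I := MvPolynomial.vanishingIdeal ℝ S
  refine ringKrullDim_le_of_forall_minimalPrimes fun p hp => ?_
  have hpp : p.IsPrime := hp.1.1
  let φ : MvPolynomial σ ℝ →ₐ[ℝ] (_ ⧸ p) := (Ideal.Quotient.mkₐ ℝ p).comp (Ideal.Quotient.mkₐ ℝ I)
  have hφ : Function.Surjective φ :=
    (Ideal.Quotient.mkₐ_surjective ℝ p).comp (Ideal.Quotient.mkₐ_surjective ℝ I)
  let P := p.comap (Ideal.Quotient.mk I)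
  have hφP : ∀ h, φ h = 0 ↔ h ∈ P := fun h => Ideal.Quotient.eq_zero_iff_mem (I := p)
  have hP : P ∈ I.minimalPrimes := by
    rw [Ideal.minimalPrimes_eq_comap]
    exact ⟨p, hp, rfl⟩
  refine ringKrullDim_le_of_linearIndependent_pderiv (K := FractionRing (_ ⧸ p)) φ hφ f
    (fun i => (hφP _).mpr (hP.1.2 ?_)) ?_
  · rw [MvPolynomial.mem_vanishingIdeal_iff]
    intro x hx
    rw [MvPolynomial.aeval_eq_eval]
    exact hf x hx i
  rw [← LinearIndependent.iff_fractionRing (R := _ ⧸ p), Fintype.linearIndependent_iff]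
  intro c hc
  -- Lift the coefficients of a dependence to polynomials. At each point of `S` in the zero locus of
  -- `P`, independence of the gradients makes them vanish, so they lie in `P`.
  choose C hC using fun i => hφ (c i)
  intro i
  rw [← hC, hφP]
  refine mem_of_mem_minimalPrimes_vanishingIdeal hP fun x hx hxP => ?_
  refine Fintype.linearIndependent_iff.mp (hind x hx) (fun i => MvPolynomial.eval x (C i)) ?_ i
  funext j
  have h1 : φ (∑ i, C i * MvPolynomial.pderiv j (f i)) = 0 := by
    apply IsFractionRing.injective (_ ⧸ p) (FractionRing (_ ⧸ p))
    rw [map_zero, ← Pi.zero_apply (M := fun _ : σ => FractionRing (_ ⧸ p)) j, ← hc]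
    simp [Finset.sum_apply, Algebra.smul_def, hC]
  simpa using hxP _ ((hφP _).mp h1)

/-- A relation among the `l i` modulo the vanishing ideal would vanish near `y`, hence on a product
of infinite sets, and so be zero. Thus the `l i` generate a polynomial ring inside the coordinate
ring. -/
theorem le_semialgebraicDim_of_mem_nhds {σ : Type} [Fintype σ] {n : ℕ} (S : Set (σ → ℝ))
    (l : Fin n → MvPolynomial σ ℝ) (y : Fin n → ℝ)
    (h : (fun x i => MvPolynomial.eval x (l i)) '' S ∈ nhds y) :
    (n : WithBot ℕ∞) ≤ semialgebraicDim S := by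
  refine le_ringKrullDim_of_injective_mvPolynomial (k := ℝ)
    ((Ideal.Quotient.mkₐ ℝ (MvPolynomial.vanishingIdeal ℝ S)).comp (MvPolynomial.aeval l)) ?_
  rw [injective_iff_map_eq_zero]
  intro p hp
  have hp' : MvPolynomial.aeval l p ∈ MvPolynomial.vanishingIdeal ℝ S :=
    Ideal.Quotient.eq_zero_iff_mem.mp hp
  rw [MvPolynomial.mem_vanishingIdeal_iff] at hp'
  obtain ⟨ε, hε, hball⟩ := Metric.mem_nhds_iff.mp h
  refine MvPolynomial.funext_set (fun i => Metric.ball (y i) ε) (fun i => ?_) fun z hz => ?_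
  · exact infinite_of_mem_nhds (y i) (Metric.ball_mem_nhds _ hε)
  · have hz' : z ∈ Metric.ball y ε := by
      rw [ball_pi _ hε]; exact hz
    obtain ⟨x, hx, rfl⟩ := hball hz'
    have := hp' x hx
    rw [MvPolynomial.aeval_eq_eval] at this
    have hcomp : (MvPolynomial.aeval x).comp (MvPolynomial.aeval l) =
        (MvPolynomial.aeval (fun i => MvPolynomial.eval x (l i)) : _ →ₐ[ℝ] ℝ) := by
      ext i; simp [MvPolynomial.aeval_eq_eval]
    rw [map_zero, ← this]
    exact (AlgHom.congr_fun hcomp p).symm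

theorem MvPolynomial.hasStrictFDerivAt_eval {σ : Type*} [Fintype σ] (p : MvPolynomial σ ℝ)
    (x : σ → ℝ) : HasStrictFDerivAt (fun y => MvPolynomial.eval y p)
      (∑ j, MvPolynomial.eval x (MvPolynomial.pderiv j p) •
        (ContinuousLinearMap.proj j : (σ → ℝ) →L[ℝ] ℝ)) x := by
  classical
  induction p using MvPolynomial.induction_on with
  | C a => simpa using hasStrictFDerivAt_const a x
  | add p q hp hq =>
    simp only [map_add, add_smul, Finset.sum_add_distrib]
    exact hp.add hq
  | mul_X p i hp =>
    have h := hp.mul (hasStrictFDerivAt_apply i x)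
    simp only [map_mul, MvPolynomial.eval_X]
    convert! h using 1
    simp [add_smul, Finset.sum_add_distrib, Finset.smul_sum, mul_smul, Pi.single_apply,
      apply_ite (MvPolynomial.eval x)]

/-- The dimension of a set that agrees, near one of its points, with the zero set of some
polynomials whose Jacobian matrix has full rank at this point. -/
theorem le_semialgebraicDim_of_eventually {σ ι : Type} [Fintype σ] [Fintype ι] (S : Set (σ → ℝ))
    (f : ι → MvPolynomial σ ℝ) (x : σ → ℝ) (hx : ∀ i, MvPolynomial.eval x (f i) = 0)
    (hind : LinearIndependent ℝ
      (fun i j => MvPolynomial.eval x (MvPolynomial.pderiv j (f i)) : ι → σ → ℝ))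
    (hS : ∀ᶠ y in nhds x, (∀ i, MvPolynomial.eval y (f i) = 0) → y ∈ S) :
    ((Fintype.card σ - Fintype.card ι : ℕ) : WithBot ℕ∞) ≤ semialgebraicDim S := by
  classical
  let D : (σ → ℝ) →ₗ[ℝ] (ι → ℝ) :=
    Matrix.mulVecLin (fun i j => MvPolynomial.eval x (MvPolynomial.pderiv j (f i)))
  have hD : Function.Surjective D := by
    rw [← LinearMap.range_eq_top]
    apply Submodule.eq_top_of_finrank_eq
    have := LinearIndependent.rank_matrix (M := (fun i j => MvPolynomial.eval x (MvPolynomial.pderiv j (f i)) : Matrix ι σ ℝ)) hind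
    rw [Module.finrank_fintype_fun_eq_card, ← this]
    rfl
  have hker : Module.finrank ℝ (LinearMap.ker D) = Fintype.card σ - Fintype.card ι := by
    have := LinearMap.finrank_range_add_finrank_ker D
    rw [LinearMap.range_eq_top.mpr hD, finrank_top] at this
    simp only [Module.finrank_fintype_fun_eq_card] at this
    omega
  obtain ⟨r, hr⟩ := (LinearMap.ker D).subtype.exists_leftInverse_of_injective (Submodule.ker_subtype _)
  let b := Module.finBasisOfFinrankEq ℝ (LinearMap.ker D) hker
  -- `r` retracts onto the tangent space `ker D`, so `L` is an isomorphism there and `(f, L)` is a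
  -- submersion at `x`. The slice of its image where `f = 0` is then a neighbourhood of `L x`.
  let L : (σ → ℝ) →ₗ[ℝ] (Fin (Fintype.card σ - Fintype.card ι) → ℝ) := b.equivFun.toLinearMap ∘ₗ r
  let l : Fin (Fintype.card σ - Fintype.card ι) → MvPolynomial σ ℝ := fun k =>
    ∑ j, MvPolynomial.C (L (fun m => if j = m then 1 else 0) k) * MvPolynomial.X j
  have hl : ∀ y, (fun k => MvPolynomial.eval y (l k)) = L y := by
    intro y
    funext k
    rw [LinearMap.pi_apply_eq_sum_univ L y]
    simp [l, mul_comm]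
  let Ψ : (σ → ℝ) → (ι → ℝ) × (Fin (Fintype.card σ - Fintype.card ι) → ℝ) :=
    fun y => (fun i => MvPolynomial.eval y (f i), L y)
  let Ψ' : (σ → ℝ) →L[ℝ] (ι → ℝ) × (Fin (Fintype.card σ - Fintype.card ι) → ℝ) :=
    (LinearMap.toContinuousLinearMap D).prod (LinearMap.toContinuousLinearMap L)
  have hΨ : HasStrictFDerivAt Ψ Ψ' x := by
    refine HasStrictFDerivAt.prodMk ?_ (LinearMap.toContinuousLinearMap L).hasStrictFDerivAt
    rw [hasStrictFDerivAt_pi']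
    intro i
    convert! MvPolynomial.hasStrictFDerivAt_eval (f i) x using 1
    ext y
    simp only [sum_apply, smul_apply]
    rfl
  have hsurj : Function.Surjective Ψ' := by
    rintro ⟨u, w⟩
    obtain ⟨a, ha⟩ := hD u
    let c : LinearMap.ker D := b.equivFun.symm (w - L a)
    refine ⟨a + c, ?_⟩
    have hc : D c = 0 := c.2
    have hrc : r c = c := LinearMap.congr_fun hr c
    have hLc : L c = w - L a := by
      rw [show L c = b.equivFun (r c) from rfl, hrc]
      exact b.equivFun.apply_symm_apply _
    simp only [Ψ', ContinuousLinearMap.prod_apply, LinearMap.coe_toContinuousLinearMap', map_add,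
      ha, hc, hLc]
    simp
  have hmap := hΨ.map_nhds_eq_of_surj (LinearMap.range_eq_top.mpr hsurj)
  refine le_semialgebraicDim_of_mem_nhds S l (L x) ?_
  have h1 : Ψ '' {y | (∀ i, MvPolynomial.eval y (f i) = 0) → y ∈ S} ∈ nhds (Ψ x) := by
    rw [← hmap]
    exact Filter.image_mem_map hS
  have h2 : Filter.Tendsto (fun z : Fin (Fintype.card σ - Fintype.card ι) → ℝ =>
      ((fun _ => 0 : ι → ℝ), z)) (nhds (L x)) (nhds (Ψ x)) := by
    have : Ψ x = ((fun _ => 0 : ι → ℝ), L x) := by simp [Ψ, hx]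
    rw [this]
    exact (Continuous.prodMk continuous_const continuous_id).tendsto _
  filter_upwards [h2 h1] with z hz
  obtain ⟨y, hy, hyz⟩ := hz
  have e1 := congrArg Prod.fst hyz
  have e2 := congrArg Prod.snd hyz
  exact ⟨y, hy fun i => congrFun e1 i, (hl y).trans e2⟩

/-! ### Polytopes, polarity and face lattices -/

/-- The points `V v` are the vertices and the inequalities `A F ⬝ᵥ y ≤ 1` define the facets of one
polytope, with vertex-facet incidences `inc`. -/
structure Realizes {d : ℕ} {ι κ : Type} (V : ι → Fin d → ℝ) (A : κ → Fin d → ℝ)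
    (inc : ι → κ → Prop) : Prop where
  hull : convexHull ℝ (Set.range V) = {y | ∀ F, A F ⬝ᵥ y ≤ 1}
  incident : ∀ v F, A F ⬝ᵥ V v = 1 ↔ inc v F

theorem mem_convexHull_range_iff {d : ℕ} {ι : Type} [Fintype ι] {V : ι → Fin d → ℝ}
    {y : Fin d → ℝ} : y ∈ convexHull ℝ (Set.range V) ↔
      ∃ w : ι → ℝ, (∀ v, 0 ≤ w v) ∧ ∑ v, w v = 1 ∧ ∑ v, w v • V v = y := by
  classical
  constructor
  · intro hy
    have h : convexHull ℝ (Set.range V) ⊆ Fintype.linearCombination ℝ V '' stdSimplex ℝ ι := by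
      refine convexHull_min ?_ ((convex_stdSimplex ℝ ι).linear_image _)
      rintro _ ⟨v, rfl⟩
      exact ⟨Pi.single v 1, single_mem_stdSimplex ℝ v, by simp⟩
    obtain ⟨w, hw, rfl⟩ := h hy
    exact ⟨w, hw.1, hw.2, (Fintype.linearCombination_apply ℝ V w).symm⟩
  · rintro ⟨w, h0, h1, h2⟩
    exact mem_convexHull_of_exists_fintype w V h0 h1 (fun v => ⟨v, rfl⟩) h2

theorem dotProduct_sum_smul {d : ℕ} {ι : Type} [Fintype ι] (V : ι → Fin d → ℝ) (w : ι → ℝ)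
    (l : Fin d → ℝ) : l ⬝ᵥ ∑ v, w v • V v = ∑ v, w v * (l ⬝ᵥ V v) := by
  simp [dotProduct_sum, dotProduct_smul]

theorem dotProduct_le_of_mem_convexHull {d : ℕ} {ι : Type} [Fintype ι] {V : ι → Fin d → ℝ}
    {y l : Fin d → ℝ} {c : ℝ} (hl : ∀ v, l ⬝ᵥ V v ≤ c) (hy : y ∈ convexHull ℝ (Set.range V)) :
    l ⬝ᵥ y ≤ c := by
  obtain ⟨w, h0, h1, rfl⟩ := mem_convexHull_range_iff.mp hy
  rw [dotProduct_sum_smul, ← one_mul c, ← h1, Finset.sum_mul]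
  exact Finset.sum_le_sum fun v _ => mul_le_mul_of_nonneg_left (hl v) (h0 v)

/-- If a convex combination attains an upper bound of a functional, so do all its terms. -/
theorem eq_of_sum_mul_eq {ι : Type} [Fintype ι] {w f : ι → ℝ} {c : ℝ} (h0 : ∀ v, 0 ≤ w v)
    (h1 : ∑ v, w v = 1) (hf : ∀ v, f v ≤ c) (h : ∑ v, w v * f v = c) {v : ι} (hv : 0 < w v) :
    f v = c := by
  have h2 : ∑ v, w v * (c - f v) = 0 := by
    simp only [mul_sub, Finset.sum_sub_distrib, ← Finset.sum_mul, h1, h]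
    ring
  have h3 := (Finset.sum_eq_zero_iff_of_nonneg fun v _ =>
    mul_nonneg (h0 v) (sub_nonneg.mpr (hf v))).mp h2 v (Finset.mem_univ v)
  rcases mul_eq_zero.mp h3 with h4 | h4 <;> linarith

theorem exists_pos_of_sum_eq_one {ι : Type} [Fintype ι] {w : ι → ℝ}
    (h1 : ∑ v, w v = 1) : ∃ v, 0 < w v := by
  by_contra! h
  have := Finset.sum_nonpos fun v (_ : v ∈ Finset.univ) => h v
  linarith

theorem StrongDual.exists_dotProduct {d : ℕ} (f : StrongDual ℝ (Fin d → ℝ)) :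
    ∃ a : Fin d → ℝ, ∀ x, f x = a ⬝ᵥ x := by
  refine ⟨fun k => f (Pi.single k 1), fun x => ?_⟩
  conv_lhs => rw [pi_eq_sum_univ' x]
  simp [dotProduct, mul_comm]

/-- The functional `x ↦ a ⬝ᵥ x`. -/
noncomputable def dotDual {d : ℕ} (a : Fin d → ℝ) : StrongDual ℝ (Fin d → ℝ) :=
  ∑ k, a k • ContinuousLinearMap.proj k

@[simp] theorem dotDual_apply {d : ℕ} (a x : Fin d → ℝ) : dotDual a x = a ⬝ᵥ x := by
  simp [dotDual, dotProduct, sum_apply, smul_apply]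

theorem isClosed_convexHull_range {d : ℕ} {ι : Type} [Fintype ι] (V : ι → Fin d → ℝ) :
    IsClosed (convexHull ℝ (Set.range V)) :=
  ((Set.finite_range V).isCompact_convexHull ℝ).isClosed

/-- Separation of a point from a polytope. -/
theorem exists_dotProduct_lt_of_notMem_convexHull {d : ℕ} {ι : Type} [Fintype ι]
    {V : ι → Fin d → ℝ} {y : Fin d → ℝ} (hy : y ∉ convexHull ℝ (Set.range V)) :
    ∃ (l : Fin d → ℝ) (u : ℝ), (∀ v, l ⬝ᵥ V v < u) ∧ u < l ⬝ᵥ y := by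
  obtain ⟨f, u, h1, h2⟩ := geometric_hahn_banach_closed_point (convex_convexHull ℝ (Set.range V))
    (isClosed_convexHull_range V) hy
  obtain ⟨l, hl⟩ := StrongDual.exists_dotProduct f
  exact ⟨l, u, fun v => hl (V v) ▸ h1 _ (subset_convexHull ℝ _ ⟨v, rfl⟩), hl y ▸ h2⟩

namespace Realizes

variable {d : ℕ} {ι κ : Type} [Fintype ι] [Fintype κ] {V : ι → Fin d → ℝ} {A : κ → Fin d → ℝ}
  {inc : ι → κ → Prop}

omit [Fintype ι] [Fintype κ] in
theorem vertex_mem (h : Realizes V A inc) (v : ι) (F : κ) : A F ⬝ᵥ V v ≤ 1 := by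
  have : V v ∈ {y | ∀ F, A F ⬝ᵥ y ≤ 1} := h.hull ▸ subset_convexHull ℝ _ ⟨v, rfl⟩
  exact this F

omit [Fintype κ] in
/-- A realized polytope is bounded. -/
theorem eq_zero_of_forall_nonpos (h : Realizes V A inc) {y : Fin d → ℝ}
    (hy : ∀ F, A F ⬝ᵥ y ≤ 0) : y = 0 := by
  by_contra hne
  obtain ⟨R, hR⟩ := ((Set.finite_range V).isCompact_convexHull ℝ).isBounded.exists_norm_le
  have hpos : 0 < ‖y‖ := norm_pos_iff.mpr hne
  have h1 : ((|R| + 1) / ‖y‖) • y ∈ convexHull ℝ (Set.range V) := by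
    rw [h.hull]
    intro F
    rw [dotProduct_smul, smul_eq_mul]
    have : 0 ≤ (|R| + 1) / ‖y‖ := by positivity
    nlinarith [hy F]
  have h2 := hR _ h1
  rw [norm_smul, Real.norm_of_nonneg (by positivity), div_mul_cancel₀ _ hpos.ne'] at h2
  linarith [le_abs_self R]

omit [Fintype ι] [Fintype κ] in
theorem zero_mem (h : Realizes V A inc) : (0 : Fin d → ℝ) ∈ convexHull ℝ (Set.range V) := by
  rw [h.hull]
  intro F
  simp

/-- Duality: the polar of the polytope is the convex hull of the facet normals. -/
theorem mem_convexHull_normals (h : Realizes V A inc) [Nonempty κ] {l : Fin d → ℝ}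
    (hl : ∀ v, l ⬝ᵥ V v ≤ 1) : l ∈ convexHull ℝ (Set.range A) := by
  by_contra hne
  obtain ⟨y, u, h1, h2⟩ := exists_dotProduct_lt_of_notMem_convexHull hne
  have h1' : ∀ F, A F ⬝ᵥ y < u := fun F => by rw [dotProduct_comm]; exact h1 F
  rw [dotProduct_comm] at h2
  have hu : 0 < u := by
    by_contra! hu
    have hy := h.eq_zero_of_forall_nonpos fun F => ((h1' F).trans_le hu).le
    subst hy
    have := h1' (Classical.arbitrary κ)
    simp only [dotProduct_zero] at this
    linarith
  have hmem : u⁻¹ • y ∈ convexHull ℝ (Set.range V) := by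
    rw [h.hull]
    intro F
    rw [dotProduct_smul, smul_eq_mul, inv_mul_le_iff₀ hu, mul_one]
    exact (h1' F).le
  have := dotProduct_le_of_mem_convexHull hl hmem
  rw [dotProduct_smul, smul_eq_mul, inv_mul_le_iff₀ hu, mul_one] at this
  linarith

omit [Fintype κ] in
theorem not_forall_dotProduct_eq_one (h : Realizes V A inc) [Nonempty κ] {y : Fin d → ℝ} :
    ¬ ∀ F, A F ⬝ᵥ y = 1 := by
  intro hy
  have := h.eq_zero_of_forall_nonpos (y := -y) fun F => by
    rw [dotProduct_neg, hy F]; norm_num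
  have h2 := hy (Classical.arbitrary κ)
  rw [neg_eq_zero.mp this, dotProduct_zero] at h2
  norm_num at h2

/-- A face is cut out by the facets that contain all its vertices. -/
theorem mem_face_iff (h : Realizes V A inc) [Nonempty κ] {S : Set (Fin d → ℝ)}
    (hS : IsExposed ℝ (convexHull ℝ (Set.range V)) S) (y : Fin d → ℝ) :
    y ∈ S ↔ y ∈ convexHull ℝ (Set.range V) ∧
      ∀ F, (∀ v, V v ∈ S → inc v F) → A F ⬝ᵥ y = 1 := by
  rcases S.eq_empty_or_nonempty with rfl | hne
  · simp only [Set.mem_empty_iff_false, IsEmpty.forall_iff, implies_true, forall_const, false_iff,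
      not_and]
    exact fun _ => h.not_forall_dotProduct_eq_one
  obtain ⟨f, hf⟩ := hS hne
  obtain ⟨l, hl⟩ := StrongDual.exists_dotProduct f
  obtain ⟨z, hz⟩ := hne
  have hzQ : z ∈ convexHull ℝ (Set.range V) := by rw [hf] at hz; exact hz.1
  have hmax : ∀ x ∈ convexHull ℝ (Set.range V), l ⬝ᵥ x ≤ l ⬝ᵥ z := by
    intro x hx
    have := hz
    rw [hf] at this
    rw [← hl, ← hl]; exact this.2 x hx
  have hmem : ∀ x, x ∈ S ↔ x ∈ convexHull ℝ (Set.range V) ∧ l ⬝ᵥ x = l ⬝ᵥ z := by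
    intro x
    rw [hf]
    constructor
    · rintro ⟨hx, hx'⟩
      exact ⟨hx, le_antisymm (hmax x hx) (by rw [← hl, ← hl]; exact hx' z hzQ)⟩
    · rintro ⟨hx, hx'⟩
      exact ⟨hx, fun w hw => by rw [hl, hl, hx']; exact hmax w hw⟩
  constructor
  · intro hy
    refine ⟨((hmem y).mp hy).1, fun F hF => ?_⟩
    obtain ⟨w, h0, h1, rfl⟩ := mem_convexHull_range_iff.mp ((hmem y).mp hy).1
    have hly := ((hmem _).mp hy).2
    rw [dotProduct_sum_smul] at hly ⊢
    have : ∀ v, w v * (A F ⬝ᵥ V v) = w v := by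
      intro v
      rcases (h0 v).eq_or_lt with hv | hv
      · simp [← hv]
      · have hvS : V v ∈ S := (hmem _).mpr ⟨subset_convexHull ℝ _ ⟨v, rfl⟩,
          eq_of_sum_mul_eq h0 h1 (fun v => hmax _ (subset_convexHull ℝ _ ⟨v, rfl⟩)) hly hv⟩
        rw [(h.incident v F).mpr (hF v hvS), mul_one]
    rw [Finset.sum_congr rfl fun v _ => this v, h1]
  · rintro ⟨hyQ, hy⟩
    refine (hmem y).mpr ⟨hyQ, ?_⟩
    -- The origin lies in the polytope. If the maximum is zero, a small step from the origin along
    -- `l` shows `l = 0`. If it is positive, rescaled `l` lies in the polar and is a convex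
    -- combination of normals; those with positive weight are tight at all vertices of `S`, hence at
    -- `y`.
    have hM : 0 ≤ l ⬝ᵥ z := by simpa using hmax 0 h.zero_mem
    rcases hM.eq_or_lt with hM | hM
    · obtain ⟨w, h0, h1, hw⟩ := mem_convexHull_range_iff.mp h.zero_mem
      have hl0 : l = 0 := by
        have hsmall : ∃ ε : ℝ, 0 < ε ∧ ∀ F, A F ⬝ᵥ (ε • l) ≤ 1 := by
          refine ⟨(∑ F, |A F ⬝ᵥ l| + 1)⁻¹, by positivity, fun F => ?_⟩
          rw [dotProduct_smul, smul_eq_mul, inv_mul_le_iff₀ (by positivity), mul_one]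
          have := Finset.single_le_sum (f := fun F => |A F ⬝ᵥ l|) (fun F _ => abs_nonneg _)
            (Finset.mem_univ F)
          have h3 := le_abs_self (A F ⬝ᵥ l)
          linarith
        obtain ⟨ε, hε, hεF⟩ := hsmall
        have := hmax (ε • l) (by rw [h.hull]; exact hεF)
        rw [← hM, dotProduct_smul, smul_eq_mul] at this
        have hll : l ⬝ᵥ l ≤ 0 := by
          by_contra! hc
          exact absurd this (not_le.mpr (mul_pos hε hc))
        have hll' : l ⬝ᵥ l = 0 := le_antisymm hll
          (Finset.sum_nonneg fun i _ => mul_self_nonneg (l i))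
        exact dotProduct_self_eq_zero.mp hll'
      simp [hl0]
    · have hdual : ((l ⬝ᵥ z)⁻¹ • l) ∈ convexHull ℝ (Set.range A) := by
        refine h.mem_convexHull_normals fun v => ?_
        rw [smul_dotProduct, smul_eq_mul, inv_mul_le_iff₀ hM, mul_one]
        exact hmax _ (subset_convexHull ℝ _ ⟨v, rfl⟩)
      obtain ⟨w, h0, h1, hw⟩ := mem_convexHull_range_iff.mp hdual
      have hval : ∀ x, ∑ F, w F * (A F ⬝ᵥ x) = (l ⬝ᵥ z)⁻¹ * (l ⬝ᵥ x) := by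
        intro x
        rw [← smul_eq_mul (l ⬝ᵥ z)⁻¹, ← smul_dotProduct, ← hw, dotProduct_comm, dotProduct_sum_smul]
        simp only [dotProduct_comm x]
      have hFy : ∀ F, w F * (A F ⬝ᵥ y) = w F := by
        intro F
        rcases (h0 F).eq_or_lt with hF | hF
        · simp [← hF]
        · rw [hy F, mul_one]
          intro v hv
          rw [← h.incident]
          refine eq_of_sum_mul_eq h0 h1 (fun F => h.vertex_mem v F) ?_ hF
          rw [hval, ((hmem _).mp hv).2, inv_mul_cancel₀ hM.ne']
      have := hval y
      rw [Finset.sum_congr rfl fun F _ => hFy F, h1, eq_inv_mul_iff_mul_eq₀ hM.ne', mul_one] at this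
      exact this.symm

omit [Fintype ι] in
/-- Intersections of facets are faces. -/
theorem isExposed_of_facets (h : Realizes V A inc) (T : κ → Prop) :
    IsExposed ℝ (convexHull ℝ (Set.range V))
      {y ∈ convexHull ℝ (Set.range V) | ∀ F, T F → A F ⬝ᵥ y = 1} := by
  classical
  rintro ⟨z, hz, hzT⟩
  refine ⟨dotDual (∑ F with T F, A F), ?_⟩
  have hval : ∀ x, (∑ F with T F, A F) ⬝ᵥ x = ∑ F with T F, A F ⬝ᵥ x := fun x => by
    rw [sum_dotProduct]
  simp only [dotDual_apply, hval]
  ext y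
  constructor
  · rintro ⟨hy, hyT⟩
    refine ⟨hy, fun x hx => Finset.sum_le_sum fun F hF => ?_⟩
    rw [hyT F (Finset.mem_filter.mp hF).2]
    rw [h.hull] at hx
    exact hx F
  · rintro ⟨hy, hmax⟩
    refine ⟨hy, fun F hF => ?_⟩
    have h1 := hmax z hz
    rw [h.hull] at hy
    by_contra hne
    have : ∑ F with T F, A F ⬝ᵥ y < ∑ F with T F, A F ⬝ᵥ z := by
      refine Finset.sum_lt_sum (fun G hG => ?_) ⟨F, by simpa using hF, ?_⟩
      · rw [hzT G (Finset.mem_filter.mp hG).2]; exact hy G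
      · rw [hzT F hF]; exact lt_of_le_of_ne (hy F) hne
    linarith

end Realizes

namespace Realizes

section Faces

variable {d : ℕ} {ι κ : Type} [Fintype ι] [Fintype κ] [Nonempty κ] {inc : ι → κ → Prop}
  {V W : ι → Fin d → ℝ} {A B : κ → Fin d → ℝ}

/-- The vertices that occur in a point of a face lie in this face. -/
theorem vertex_mem_face (h : Realizes V A inc) {S : Set (Fin d → ℝ)}
    (hS : IsExposed ℝ (convexHull ℝ (Set.range V)) S) {w : ι → ℝ} (h0 : ∀ v, 0 ≤ w v)
    (h1 : ∑ v, w v = 1) (hy : ∑ v, w v • V v ∈ S) {v : ι} (hv : 0 < w v) : V v ∈ S := by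
  rw [h.mem_face_iff hS] at hy ⊢
  refine ⟨subset_convexHull ℝ _ ⟨v, rfl⟩, fun F hF => ?_⟩
  have := hy.2 F hF
  rw [dotProduct_sum_smul] at this
  exact eq_of_sum_mul_eq h0 h1 (fun v => h.vertex_mem v F) this hv

theorem face_ext (h : Realizes V A inc) {S T : Set (Fin d → ℝ)}
    (hS : IsExposed ℝ (convexHull ℝ (Set.range V)) S)
    (hT : IsExposed ℝ (convexHull ℝ (Set.range V)) T) (hST : ∀ v, V v ∈ S ↔ V v ∈ T) : S = T := by
  ext y
  rw [h.mem_face_iff hS, h.mem_face_iff hT]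
  simp only [hST]

/-- The face of the second polytope with the same facets as a face of the first. -/
def transferFace (V : ι → Fin d → ℝ) (h' : Realizes W B inc)
    (S : Face (convexHull ℝ (Set.range V))) : Face (convexHull ℝ (Set.range W)) :=
  ⟨_, h'.isExposed_of_facets fun F => ∀ v, V v ∈ S.1 → inc v F⟩

/-- By `mem_face_iff`, a vertex lies on all facets through `S` exactly if it belongs to `S`, and the
second realization sees the same incidences. With `face_ext` this makes the two transfers mutually
inverse. -/
theorem vertex_mem_transferFace (h : Realizes V A inc) (h' : Realizes W B inc)
    (S : Face (convexHull ℝ (Set.range V))) (v : ι) :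
    W v ∈ (transferFace V h' S).1 ↔ V v ∈ S.1 := by
  rw [h.mem_face_iff S.2]
  simp only [transferFace, Set.mem_ofPred_eq, subset_convexHull ℝ _ (Set.mem_range_self v),
    h.incident, h'.incident, true_and]

theorem transferFace_transferFace (h : Realizes V A inc) (h' : Realizes W B inc)
    (S : Face (convexHull ℝ (Set.range V))) :
    transferFace W h (transferFace V h' S) = S := by
  refine Subtype.ext (h.face_ext (Subtype.prop _) S.2 fun v => ?_)
  rw [vertex_mem_transferFace h' h, vertex_mem_transferFace h h']

omit [Fintype ι] [Nonempty κ] in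
theorem transferFace_mono (h' : Realizes W B inc) :
    Monotone (transferFace V h') := by
  intro S T hST y hy
  exact ⟨hy.1, fun F hF => hy.2 F fun v hv => hF v (hST hv)⟩

/-- Two realizations of the same incidences have isomorphic face lattices. -/
def faceIso (h : Realizes V A inc) (h' : Realizes W B inc) :
    Face (convexHull ℝ (Set.range V)) ≃o Face (convexHull ℝ (Set.range W)) :=
  Equiv.toOrderIso ⟨transferFace V h', transferFace W h, transferFace_transferFace h h',
    transferFace_transferFace h' h⟩ (transferFace_mono h') (transferFace_mono h)

end Faces

end Realizes

/-- The centered realization space consists of the pairs of matrices that realize the vertex-facet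
incidences. -/
theorem mem_centeredRealizationSpace_iff {d : ℕ} {P : Set (Fin d → ℝ)} [Fintype (Vertex P)]
    [Fintype (Facet P)] [Nonempty (Facet P)] {A₀ : Facet P → Fin d → ℝ}
    (hP : P = convexHull ℝ (Set.range fun v : Vertex P => v.1))
    (h₀ : Realizes (fun v : Vertex P => v.1) A₀ fun v F => v.1 ∈ F.pts) (x : Coord P → ℝ) :
    x ∈ centeredRealizationSpace P ↔
      Realizes (vcol x) (acol x) fun v F => v.1 ∈ F.pts := by
  constructor
  · rintro ⟨hull, φ, hv, hF⟩
    refine ⟨hull, fun v F => ?_⟩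
    have h1 : v.1 ∈ F.pts ↔ v.face ≤ F.1 := Set.singleton_subset_iff.symm
    have h2 : φ v.face ≤ φ F.1 ↔ (φ v.face).1 ⊆ (φ F.1).1 := Iff.rfl
    rw [h1, ← φ.le_iff_le, h2, hv, hF, Set.singleton_subset_iff]
    exact ⟨fun h => ⟨subset_convexHull ℝ _ ⟨v, rfl⟩, h⟩, fun h => h.2⟩
  · intro h
    have key : ∃ φ : Face (convexHull ℝ (Set.range fun v : Vertex P => v.1)) ≃o
        Face (convexHull ℝ (Set.range (vcol x))),
        ∀ S v, vcol x v ∈ (φ S).1 ↔ v.1 ∈ S.1 :=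
      ⟨h₀.faceIso h, fun S v => h₀.vertex_mem_transferFace h S v⟩
    rw [← hP] at key
    obtain ⟨φ, hφ⟩ := key
    refine ⟨h.hull, φ, fun v => ?_, fun F => ?_⟩
    · ext y
      rw [Set.mem_singleton_iff]
      constructor
      -- The image face contains no labelled point with a label other than `v`, so convex
      -- combinations in it collapse to one point.
      · intro hy
        obtain ⟨w, w0, w1, rfl⟩ := mem_convexHull_range_iff.mp ((φ v.face).2.subset hy)
        have huv : ∀ u, 0 < w u → u = v := fun u hu => by
          have := (hφ _ _).mp (h.vertex_mem_face (φ v.face).2 w0 w1 hy hu)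
          exact Subtype.ext this
        have hw : ∀ u, w u • vcol x u = w u • vcol x v := fun u => by
          rcases (w0 u).eq_or_lt with hu | hu
          · simp [← hu]
          · rw [huv u hu]
        rw [Finset.sum_congr rfl fun u _ => hw u, ← Finset.sum_smul, w1, one_smul]
      · rintro rfl
        exact (hφ _ _).mpr rfl
    · have hT := h.isExposed_of_facets (· = F)
      simp only [forall_eq] at hT
      refine h.face_ext (φ F.1).2 hT fun v => ?_
      rw [hφ, Set.mem_ofPred_eq, h.incident]
      exact ⟨fun hv => ⟨subset_convexHull ℝ _ ⟨v, rfl⟩, hv⟩, fun hv => hv.2⟩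

/-! ### Stability of realizations under deformation -/

theorem ContinuousAt.dotProduct_fun {X : Type*} [TopologicalSpace X] {d : ℕ}
    {f g : X → Fin d → ℝ} {x : X} (hf : ContinuousAt f x) (hg : ContinuousAt g x) :
    ContinuousAt (fun z => f z ⬝ᵥ g z) x := by
  have h : Continuous fun p : (Fin d → ℝ) × (Fin d → ℝ) => p.1 ⬝ᵥ p.2 :=
    continuous_fst.dotProduct continuous_snd
  exact ContinuousAt.comp (f := fun z => (f z, g z)) h.continuousAt (hf.prodMk hg)

/-- A bounded polyhedron is the convex hull of given points if the facets that contain a point of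
it always have one of these points in common. -/
theorem mem_convexHull_of_tight {d : ℕ} {ι κ : Type} [Fintype κ] {V : ι → Fin d → ℝ}
    {A : κ → Fin d → ℝ} (hle : ∀ v F, A F ⬝ᵥ V v ≤ 1) {R : ℝ}
    (hR : ∀ y : Fin d → ℝ, (∀ F, A F ⬝ᵥ y ≤ 1) → ‖y‖ ≤ R)
    (htight : ∀ y : Fin d → ℝ, (∀ F, A F ⬝ᵥ y ≤ 1) →
      ∃ v, ∀ F, A F ⬝ᵥ y = 1 → A F ⬝ᵥ V v = 1)
    (y : Fin d → ℝ) (hy : ∀ F, A F ⬝ᵥ y ≤ 1) : y ∈ convexHull ℝ (Set.range V) := by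
  classical
  -- Induction on the number of inequalities that are not tight at `y`. The ray from `V v` through
  -- `y` keeps those that are tight and, by boundedness, runs into a new one; `y` lies between `V v`
  -- and this exit point.
  induction hn : (Finset.univ.filter fun F => A F ⬝ᵥ y ≠ 1).card using Nat.strong_induction_on
    generalizing y with
  | _ n ih =>
  obtain ⟨v, hv⟩ := htight y hy
  have hVv : V v ∈ convexHull ℝ (Set.range V) := subset_convexHull ℝ _ ⟨v, rfl⟩
  by_cases hyv : y = V v
  · rwa [hyv]
  have hadd : ∀ F (s : ℝ), A F ⬝ᵥ (V v + s • (y - V v)) =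
      A F ⬝ᵥ V v + s * (A F ⬝ᵥ y - A F ⬝ᵥ V v) := by
    intro F s
    rw [dotProduct_add, dotProduct_smul, dotProduct_sub, smul_eq_mul]
  have hpos : (Finset.univ.filter fun F => 0 < A F ⬝ᵥ y - A F ⬝ᵥ V v).Nonempty := by
    by_contra hempty
    rw [Finset.not_nonempty_iff_eq_empty, Finset.filter_eq_empty_iff] at hempty
    have hnorm : 0 < ‖y - V v‖ := norm_pos_iff.mpr (sub_ne_zero.mpr hyv)
    have hs : 0 ≤ (|R| + ‖V v‖ + 1) / ‖y - V v‖ := by positivity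
    have h1 := hR (V v + ((|R| + ‖V v‖ + 1) / ‖y - V v‖) • (y - V v)) fun F => by
      rw [hadd]
      have := not_lt.mp (hempty (Finset.mem_univ F))
      nlinarith [hle v F]
    have h2 : ‖((|R| + ‖V v‖ + 1) / ‖y - V v‖) • (y - V v)‖ = |R| + ‖V v‖ + 1 := by
      rw [norm_smul, Real.norm_of_nonneg hs, div_mul_cancel₀ _ hnorm.ne']
    have h3 := norm_sub_le (V v + ((|R| + ‖V v‖ + 1) / ‖y - V v‖) • (y - V v)) (V v)
    rw [add_sub_cancel_left, h2] at h3
    linarith [le_abs_self R]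
  obtain ⟨F₀, hF₀, hmin⟩ := Finset.exists_min_image _
    (fun F => (1 - A F ⬝ᵥ V v) / (A F ⬝ᵥ y - A F ⬝ᵥ V v)) hpos
  have hg : 0 < A F₀ ⬝ᵥ y - A F₀ ⬝ᵥ V v := (Finset.mem_filter.mp hF₀).2
  set s := (1 - A F₀ ⬝ᵥ V v) / (A F₀ ⬝ᵥ y - A F₀ ⬝ᵥ V v) with hsdef
  have hs : 1 ≤ s := by
    rw [hsdef, le_div_iff₀ hg]
    linarith [hy F₀]
  have hs0 : A F₀ ⬝ᵥ (V v + s • (y - V v)) = 1 := by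
    rw [hadd, hsdef, div_mul_cancel₀ _ hg.ne']
    ring
  have hmem : V v + s • (y - V v) ∈ convexHull ℝ (Set.range V) := by
    refine ih _ ?_ _ (fun F => ?_) rfl
    · rw [← hn]
      refine Finset.card_lt_card (Finset.ssubset_iff_subset_ne.mpr ⟨fun F hF => ?_, fun heq => ?_⟩)
      · simp only [Finset.mem_filter, Finset.mem_univ, true_and] at hF ⊢
        intro hFy
        apply hF
        rw [hadd, hFy, hv F hFy]
        ring
      · have : F₀ ∈ Finset.univ.filter fun F => A F ⬝ᵥ y ≠ 1 := by
          simp only [Finset.mem_filter, Finset.mem_univ, true_and]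
          intro h
          rw [h, hv F₀ h] at hg
          linarith
        rw [← heq] at this
        exact (Finset.mem_filter.mp this).2 hs0
    · rw [hadd]
      rcases le_or_gt (A F ⬝ᵥ y - A F ⬝ᵥ V v) 0 with hF | hF
      · nlinarith [hle v F]
      · have := hmin F (by simpa using hF)
        rw [le_div_iff₀ hF] at this
        linarith
  have hconv := (convex_convexHull ℝ (Set.range V)) hVv hmem
    (a := 1 - s⁻¹) (b := s⁻¹) (by linarith [inv_le_one_of_one_le₀ hs]) (by positivity) (by ring)
  convert hconv using 1
  rw [smul_add, smul_smul, inv_mul_cancel₀ (by positivity), one_smul, sub_smul, one_smul]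
  abel

namespace Realizes

variable {X : Type} [TopologicalSpace X] {d : ℕ} {ι κ : Type} [Fintype ι] [Fintype κ]
  {V : X → ι → Fin d → ℝ} {A : X → κ → Fin d → ℝ} {inc : ι → κ → Prop} {x₀ : X}

/-- Near a realization, the equations for the incidences suffice for a realization. -/
theorem eventually (h : Realizes (V x₀) (A x₀) inc) (hV : ∀ v, ContinuousAt (fun x => V x v) x₀)
    (hA : ∀ F, ContinuousAt (fun x => A x F) x₀) :
    ∀ᶠ x in 𝓝 x₀, (∀ v F, inc v F → A x F ⬝ᵥ V x v = 1) → Realizes (V x) (A x) inc := by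
  have hstrict : ∀ᶠ x in 𝓝 x₀, ∀ v F, ¬ inc v F → A x F ⬝ᵥ V x v < 1 := by
    refine eventually_all.mpr fun v => eventually_all.mpr fun F => ?_
    by_cases hvF : inc v F
    · exact Eventually.of_forall fun _ h => absurd hvF h
    · have hlt : A x₀ F ⬝ᵥ V x₀ v < 1 :=
        lt_of_le_of_ne (h.vertex_mem v F) (mt (h.incident v F).mp hvF)
      filter_upwards [((hA F).dotProduct_fun (hV v)).eventually_lt_const hlt] with x hx _
      exact hx
  have hcont : ∀ F y, ContinuousAt (fun z : X × (Fin d → ℝ) => A z.1 F ⬝ᵥ z.2) (x₀, y) :=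
    fun F y => ContinuousAt.dotProduct_fun
      (ContinuousAt.comp (f := Prod.fst) (x := (x₀, y)) (hA F) continuousAt_fst) continuousAt_snd
  obtain ⟨R', hR'⟩ := ((Set.finite_range (V x₀)).isCompact_convexHull ℝ).isBounded.exists_norm_le
  -- The sphere of radius `R` misses the initial polytope. By compactness it also misses the nearby
  -- polyhedra; these are closed under shrinking towards the origin, so they stay in the ball.
  set R := |R'| + 1
  have hRpos : 0 < R := by positivity
  have hsphere : ∀ᶠ x in 𝓝 x₀, ∀ y ∈ Metric.sphere (0 : Fin d → ℝ) R, ∃ F, 1 < A x F ⬝ᵥ y := by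
    refine (isCompact_sphere 0 R).eventually_forall_of_forall_eventually fun y hy => ?_
    have : ∃ F, 1 < A x₀ F ⬝ᵥ y := by
      by_contra! hc
      have h1 := hR' y (by rw [h.hull]; exact hc)
      rw [mem_sphere_zero_iff_norm.mp hy] at h1
      linarith [le_abs_self R']
    obtain ⟨F, hF⟩ := this
    filter_upwards [(hcont F y).eventually_const_lt hF] with z hz
    exact ⟨F, hz⟩
  -- A vertex of positive weight in `y` lies on all facets tight at `y`, and the other facets stay
  -- slack nearby. Compactness of the ball makes this uniform, as `mem_convexHull_of_tight`
  -- requires.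
  have hball : ∀ᶠ x in 𝓝 x₀, ∀ y ∈ Metric.closedBall (0 : Fin d → ℝ) R, (∀ F, A x F ⬝ᵥ y ≤ 1) →
      ∃ v, ∀ F, A x F ⬝ᵥ y = 1 → inc v F := by
    refine (isCompact_closedBall 0 R).eventually_forall_of_forall_eventually fun y hy => ?_
    by_cases hyP : ∀ F, A x₀ F ⬝ᵥ y ≤ 1
    · have hyQ : y ∈ convexHull ℝ (Set.range (V x₀)) := by rw [h.hull]; exact hyP
      obtain ⟨w, h0, h1, rfl⟩ := mem_convexHull_range_iff.mp hyQ
      obtain ⟨v, hv⟩ := exists_pos_of_sum_eq_one h1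
      have : ∀ F, ∀ᶠ z : X × (Fin d → ℝ) in 𝓝 (x₀, ∑ v, w v • V x₀ v),
          A z.1 F ⬝ᵥ z.2 = 1 → inc v F := by
        intro F
        by_cases hF : A x₀ F ⬝ᵥ ∑ v, w v • V x₀ v = 1
        · refine Eventually.of_forall fun _ _ => ?_
          rw [dotProduct_sum_smul] at hF
          exact (h.incident v F).mp (eq_of_sum_mul_eq h0 h1 (fun v => h.vertex_mem v F) hF hv)
        · filter_upwards [(hcont F _).eventually_ne hF] with z hz hz'
          exact absurd hz' hz
      filter_upwards [eventually_all.mpr this] with z hz _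
      exact ⟨v, hz⟩
    · push Not at hyP
      obtain ⟨F, hF⟩ := hyP
      filter_upwards [(hcont F y).eventually_const_lt hF] with z hz hz'
      exact absurd (hz' F) (not_le.mpr hz)
  filter_upwards [hstrict, hsphere, hball] with x hx1 hx2 hx3 hx4
  have hle : ∀ v F, A x F ⬝ᵥ V x v ≤ 1 := fun v F => by
    by_cases hvF : inc v F
    · exact (hx4 v F hvF).le
    · exact (hx1 v F hvF).le
  have hbd : ∀ y : Fin d → ℝ, (∀ F, A x F ⬝ᵥ y ≤ 1) → ‖y‖ ≤ R := by
    intro y hy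
    by_contra! hc
    have hy0 : 0 < ‖y‖ := hRpos.trans hc
    obtain ⟨F, hF⟩ := hx2 ((R / ‖y‖) • y) (by
      rw [mem_sphere_zero_iff_norm, norm_smul, Real.norm_of_nonneg (by positivity),
        div_mul_cancel₀ _ hy0.ne'])
    rw [dotProduct_smul, smul_eq_mul] at hF
    have h1 : R / ‖y‖ ≤ 1 := (div_le_one hy0).mpr hc.le
    have h2 : 0 < R / ‖y‖ := by positivity
    nlinarith [hy F]
  refine ⟨Set.Subset.antisymm ?_ ?_, fun v F => ⟨fun hvF => ?_, hx4 v F⟩⟩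
  · intro y hy F
    exact dotProduct_le_of_mem_convexHull (fun v => hle v F) hy
  · refine mem_convexHull_of_tight hle hbd fun y hy => ?_
    obtain ⟨v, hv⟩ := hx3 y (mem_closedBall_zero_iff.mpr (hbd y hy)) hy
    exact ⟨v, fun F hF => hx4 v F (hv F hF)⟩
  · by_contra hc
    exact (hx1 v F hc).ne hvF

/-- In a connected family that satisfies the equations for the incidences and strict inequalities
for all other pairs, one realization makes all members realizations. -/
theorem of_preconnectedSpace [PreconnectedSpace X] (hV : ∀ v, Continuous fun x => V x v)
    (hA : ∀ F, Continuous fun x => A x F) (hinc : ∀ x v F, inc v F → A x F ⬝ᵥ V x v = 1)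
    (hlt : ∀ x v F, ¬ inc v F → A x F ⬝ᵥ V x v < 1) (h : Realizes (V x₀) (A x₀) inc) (x : X) :
    Realizes (V x) (A x) inc := by
  have hopen : IsOpen {x | Realizes (V x) (A x) inc} := by
    rw [isOpen_iff_mem_nhds]
    intro x hx
    filter_upwards [Realizes.eventually hx (fun v => (hV v).continuousAt)
      fun F => (hA F).continuousAt] with z hz
    exact hz (hinc z)
  -- At a limit, let `y` satisfy the inequalities but lie off the hull. A slightly shrunk `s • y`
  -- satisfies them strictly and is still strictly separated from the vertices; both properties
  -- persist at nearby realizations, where they contradict each other.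
  have hclosed : IsClosed {x | Realizes (V x) (A x) inc} := by
    refine isClosed_of_closure_subset fun x hx => ?_
    have hle : ∀ v F, A x F ⬝ᵥ V x v ≤ 1 := fun v F => by
      by_cases hvF : inc v F
      · exact (hinc x v F hvF).le
      · exact (hlt x v F hvF).le
    refine ⟨Set.Subset.antisymm ?_ ?_, fun v F => ⟨fun hvF => ?_, hinc x v F⟩⟩
    · intro y hy F
      exact dotProduct_le_of_mem_convexHull (fun v => hle v F) hy
    · intro y hy
      by_contra hyQ
      obtain ⟨l, u, hl, hu⟩ := exists_dotProduct_lt_of_notMem_convexHull hyQ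
      have hs : ∀ᶠ s : ℝ in 𝓝[<] 1, u < s * (l ⬝ᵥ y) := by
        have : ContinuousAt (fun s : ℝ => s * (l ⬝ᵥ y)) 1 := by fun_prop
        exact (this.eventually_const_lt (by simpa using hu)).filter_mono nhdsWithin_le_nhds
      have hs0 : ∀ᶠ s : ℝ in 𝓝[<] 1, 0 < s :=
        (eventually_gt_nhds (by norm_num)).filter_mono nhdsWithin_le_nhds
      obtain ⟨s, ⟨hs1, hs0⟩, hs2⟩ := ((hs.and hs0).and self_mem_nhdsWithin).exists
      have hs2 : s < 1 := hs2
      have e1 : ∀ᶠ z in 𝓝 x, ∀ F, A z F ⬝ᵥ (s • y) < 1 := by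
        refine eventually_all.mpr fun F =>
          ((hA F).continuousAt.dotProduct_fun continuousAt_const).eventually_lt_const ?_
        change A x F ⬝ᵥ (s • y) < 1
        rw [dotProduct_smul, smul_eq_mul]
        nlinarith [hy F]
      have e2 : ∀ᶠ z in 𝓝 x, ∀ v, l ⬝ᵥ V z v < u := eventually_all.mpr fun v =>
        (continuousAt_const.dotProduct_fun (hV v).continuousAt).eventually_lt_const (hl v)
      obtain ⟨z, hz, hz1, hz2⟩ :=
        ((mem_closure_iff_frequently.mp hx).and_eventually (e1.and e2)).exists
      have hmem : s • y ∈ convexHull ℝ (Set.range (V z)) := by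
        rw [Realizes.hull hz]
        exact fun F => (hz1 F).le
      have := dotProduct_le_of_mem_convexHull (fun v => (hz2 v).le) hmem
      rw [dotProduct_smul, smul_eq_mul] at this
      linarith
    · by_contra hc
      exact (hlt x v F hc).ne hvF
  have := IsClopen.eq_univ ⟨hclosed, hopen⟩ ⟨x₀, h⟩
  exact Set.eq_univ_iff_forall.mp this x

end Realizes

/-! ### Integer data of the 24-cell and finite checks -/

/-- The vertices `± e i ± e j` of the 24-cell. -/
def vertexConst : Fin 24 → Fin 4 → ℤ :=
  ![![1, 1, 0, 0], ![-1, -1, 0, 0], ![-1, 1, 0, 0], ![1, -1, 0, 0],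
    ![0, 0, 1, -1], ![0, 0, -1, 1], ![0, 0, 1, 1], ![0, 0, -1, -1],
    ![1, 0, 1, 0], ![-1, 0, -1, 0], ![0, 1, 0, 1], ![0, -1, 0, -1],
    ![-1, 0, 1, 0], ![1, 0, -1, 0], ![0, -1, 0, 1], ![0, 1, 0, -1],
    ![1, 0, 0, 1], ![-1, 0, 0, -1], ![0, 1, -1, 0], ![0, -1, 1, 0],
    ![0, 1, 1, 0], ![0, -1, -1, 0], ![-1, 0, 0, 1], ![1, 0, 0, -1]]

/-- The directions in which the vertices move in a family of 24-cells. -/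
def vertexSlope : Fin 24 → Fin 4 → ℤ :=
  ![![0, 0, -1, 0], ![0, 0, 1, 0], ![0, 0, 0, -1], ![0, 0, 0, 1],
    ![1, 0, 0, 0], ![-1, 0, 0, 0], ![0, 1, 0, 0], ![0, -1, 0, 0],
    ![0, 0, 0, -1], ![0, 0, 0, 1], ![0, 0, 1, 0], ![0, 0, -1, 0],
    ![0, -1, 0, 0], ![0, 1, 0, 0], ![1, 0, 0, 0], ![-1, 0, 0, 0],
    ![0, -1, 0, 0], ![0, 1, 0, 0], ![1, 0, 0, 0], ![-1, 0, 0, 0],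
    ![0, 0, 0, 1], ![0, 0, 0, -1], ![0, 0, -1, 0], ![0, 0, 1, 0]]

/-- Twice the facet normals of the 24-cell. -/
def normalConst : Fin 24 → Fin 4 → ℤ :=
  ![![2, 0, 0, 0], ![-2, 0, 0, 0], ![0, 2, 0, 0], ![0, -2, 0, 0],
    ![0, 0, 2, 0], ![0, 0, -2, 0], ![0, 0, 0, 2], ![0, 0, 0, -2],
    ![1, 1, 1, 1], ![-1, -1, -1, -1], ![-1, 1, -1, 1], ![1, -1, 1, -1],
    ![-1, 1, 1, -1], ![1, -1, -1, 1], ![-1, -1, 1, 1], ![1, 1, -1, -1],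
    ![-1, 1, 1, 1], ![1, -1, -1, -1], ![-1, -1, -1, 1], ![1, 1, 1, -1],
    ![-1, 1, -1, -1], ![1, -1, 1, 1], ![-1, -1, 1, -1], ![1, 1, -1, 1]]

/-- The directions in which the facet normals move, up to scaling. -/
def normalSlope : Fin 24 → Fin 4 → ℤ :=
  ![![1, 0, 0, 0], ![-1, 0, 0, 0], ![0, 1, 0, 0], ![0, -1, 0, 0],
    ![0, 0, 1, 0], ![0, 0, -1, 0], ![0, 0, 0, 1], ![0, 0, 0, -1],
    ![2, 0, 0, 0], ![-2, 0, 0, 0], ![0, 2, 0, 0], ![0, -2, 0, 0],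
    ![0, 0, 2, 0], ![0, 0, -2, 0], ![0, 0, 0, 2], ![0, 0, 0, -2],
    ![-2, 0, 0, 0], ![2, 0, 0, 0], ![0, -2, 0, 0], ![0, 2, 0, 0],
    ![0, 0, -2, 0], ![0, 0, 2, 0], ![0, 0, 0, -2], ![0, 0, 0, 2]]

/-- The vertex-facet incidences of the 24-cell, as bit masks. -/
def incidenceMask : Fin 24 → ℕ :=
  ![8945925, 4473354, 1119238, 2238473, 4724880, 8660064, 2179408, 1213088,
    2623761, 1312290, 8455492, 4328072, 4280338, 8560673, 2383944, 1609860,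
    10494273, 5247618, 9471012, 6309912, 594196, 401960, 345154, 690305]

/-- The positions of the vertices in an ordering of the vertices and facets. -/
def vertexPos : Fin 24 → ℕ :=
  ![0, 27, 22, 17, 12, 33, 13, 28, 1, 29, 9, 18, 23, 37, 38, 10, 4, 24, 34, 19, 6, 30, 35, 7]

/-- The positions of the facets in an ordering of the vertices and facets. -/
def facetPos : Fin 24 → ℕ :=
  ![2, 25, 8, 20, 11, 31, 14, 15, 3, 26, 32, 16, 21, 36, 39, 40, 41, 42, 43, 5, 44, 45, 46, 47]

/-- An order in which the incidences can be eliminated. -/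
def eliminationSteps : List (Bool × Fin 24 × Fin 24 × Fin 24) :=
  [(true, 0, 19, 18), (true, 0, 2, 13), (true, 0, 15, 5), (true, 0, 23, 1),
    (true, 8, 19, 19), (true, 8, 4, 3), (true, 8, 11, 6), (true, 8, 21, 0),
    (false, 0, 16, 17), (false, 0, 3, 15), (false, 0, 13, 7), (false, 0, 23, 1),
    (false, 8, 16, 16), (false, 8, 6, 2), (false, 8, 10, 4), (false, 8, 20, 0),
    (true, 16, 21, 5), (true, 16, 6, 13), (true, 16, 13, 0), (true, 16, 23, 1),
    (false, 19, 20, 7), (false, 19, 4, 15), (false, 19, 15, 0), (false, 19, 23, 1),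
    (true, 20, 2, 12), (true, 20, 4, 2), (true, 20, 12, 6), (true, 20, 16, 0),
    (true, 23, 11, 7), (true, 23, 7, 13), (true, 23, 15, 3), (true, 23, 17, 0),
    (false, 2, 10, 20), (false, 2, 2, 15), (false, 2, 15, 5), (false, 2, 18, 0),
    (true, 10, 16, 5), (true, 10, 6, 18), (true, 10, 10, 0), (true, 10, 23, 1),
    (true, 15, 12, 7), (true, 15, 7, 18), (true, 15, 15, 2), (true, 15, 20, 0),
    (false, 4, 4, 14), (false, 4, 6, 22), (false, 4, 12, 3), (false, 4, 19, 0),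
    (true, 4, 11, 17), (true, 4, 7, 12), (true, 4, 12, 1), (true, 4, 22, 0),
    (true, 6, 16, 14), (true, 6, 6, 19), (true, 6, 14, 3), (true, 6, 21, 0),
    (false, 6, 5, 14), (false, 6, 14, 1), (false, 6, 22, 0), (false, 7, 7, 22),
    (false, 7, 11, 1), (false, 7, 17, 0), (false, 11, 3, 22), (false, 11, 11, 4),
    (false, 11, 19, 0), (true, 3, 17, 14), (true, 3, 3, 16), (true, 3, 13, 6),
    (true, 3, 21, 0), (true, 11, 17, 1), (true, 11, 3, 17), (true, 11, 9, 4),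
    (true, 11, 22, 0), (true, 19, 21, 1), (true, 19, 3, 12), (true, 19, 14, 4),
    (true, 19, 22, 0), (false, 3, 1, 13), (false, 3, 14, 5), (false, 3, 21, 0),
    (false, 12, 2, 22), (false, 12, 12, 7), (false, 12, 17, 0), (true, 2, 16, 9),
    (true, 2, 1, 18), (true, 2, 10, 7), (true, 2, 20, 0), (true, 12, 16, 1),
    (true, 12, 1, 19), (true, 12, 14, 4), (true, 12, 22, 0), (true, 17, 20, 1),
    (true, 17, 1, 11), (true, 17, 9, 4), (true, 17, 22, 0), (false, 1, 1, 10),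
    (false, 1, 9, 6), (false, 1, 22, 0), (false, 9, 1, 5), (false, 9, 7, 18),
    (false, 9, 9, 3), (false, 9, 21, 0), (true, 1, 18, 12), (true, 1, 14, 4),
    (true, 1, 22, 0), (true, 7, 17, 18), (true, 7, 5, 15), (true, 7, 15, 2),
    (true, 7, 20, 0), (true, 9, 18, 18), (true, 9, 5, 2), (true, 9, 10, 7),
    (true, 9, 20, 0), (true, 21, 17, 5), (true, 21, 5, 14), (true, 21, 13, 1),
    (true, 21, 18, 0), (false, 5, 5, 15), (false, 5, 13, 2), (false, 5, 18, 0),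
    (false, 10, 18, 6), (false, 10, 5, 1), (false, 10, 22, 0), (true, 5, 18, 13),
    (true, 5, 13, 0), (true, 5, 23, 1), (true, 18, 20, 0), (true, 18, 15, 5),
    (true, 18, 23, 1), (true, 22, 16, 1), (true, 22, 14, 5), (true, 22, 18, 0),
    (false, 13, 13, 3), (false, 13, 14, 0), (true, 13, 17, 0), (true, 13, 15, 5),
    (true, 13, 23, 1), (true, 14, 18, 6), (true, 14, 14, 3), (true, 14, 21, 0)]

/-- Directions for the vertices in four deformations. -/
def vertexDir : Fin 4 → List (Fin 24 × (Fin 4 → ℤ)) :=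
  ![[(0, ![-1035, -1200, 145, 310]),
     (3, ![-420, 0, 0, 420]),
     (8, ![-45, 90, 0, 135]),
     (10, ![400, 400, 400, 0]),
     (13, ![-1180, -1140, 0, 40]),
     (15, ![-800, -800, 0, 0]),
     (16, ![-1080, -1080, 0, 0]),
     (18, ![-1200, -800, 0, 400]),
     (23, ![-740, -240, 20, 0])],
    [(0, ![650, 1050, -1690, -900]),
     (3, ![1260, 0, 0, -1260]),
     (8, ![345, -130, 0, -475]),
     (10, ![450, 450, 450, 0]),
     (13, ![1980, 1080, 0, -900]),
     (16, ![-480, -480, 0, 0]),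
     (18, ![1800, 1200, 0, -600]),
     (23, ![1530, 30, -750, 0])],
    [(0, ![-2115, 675, 305, 140]),
     (3, ![-630, 0, 0, 630]),
     (8, ![-855, -390, 0, 465]),
     (10, ![-1425, -1425, -1425, 0]),
     (13, ![-1170, -810, 0, 360]),
     (15, ![1500, 1500, 0, 0]),
     (16, ![-1420, -1420, 0, 0]),
     (18, ![-450, -300, 0, 150]),
     (23, ![-885, -135, 255, 0])],
    [(0, ![2845, 575, 4375, 30]),
     (3, ![-420, 0, 0, 420]),
     (8, ![270, 300, 0, 30]),
     (10, ![-1125, -1125, -1125, 0]),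
     (13, ![-720, -450, 0, 270]),
     (15, ![1200, 1200, 0, 0]),
     (16, ![-760, -760, 0, 0]),
     (18, ![-300, -200, 0, 100]),
     (23, ![325, 825, 1085, 0])]]

/-- Directions for the facet normals in four deformations. -/
def normalDir : Fin 4 → List (Fin 24 × (Fin 4 → ℤ)) :=
  ![[(0, ![1050, 860, 300, 460]),
     (2, ![800, 400, 0, -800]),
     (8, ![1552, -512, 768, -512]),
     (11, ![192, -96, 0, 96]),
     (15, ![384, 704, -224, -128]),
     (17, ![504, 0, 0, 0]),
     (19, ![384, 768, -576, -384]),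
     (23, ![704, -128, -256, 96])],
    [(0, ![-660, 1560, 2100, 1920]),
     (2, ![-300, -450, 600, -300]),
     (8, ![864, -576, 864, -576]),
     (11, ![-576, 288, 0, -288]),
     (15, ![-1200, -672, 408, -72]),
     (17, ![-1512, 0, 0, 0]),
     (19, ![-448, -224, 224, 0]),
     (23, ![-48, -480, 216, 192])],
    [(0, ![1250, 940, 550, 640]),
     (2, ![-1050, -75, -900, 1950]),
     (8, ![792, 1824, -2736, 1824]),
     (11, ![288, -144, 0, 144]),
     (15, ![1008, -312, -228, 384]),
     (17, ![756, 0, 0, 0]),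
     (19, ![960, -600, 240, 720]),
     (23, ![656, 8, 156, 484])],
    [(0, ![335, 170, -300, 510]),
     (2, ![-850, -75, -700, 1550]),
     (8, ![192, 1440, -2160, 1440]),
     (11, ![192, -96, 0, 96]),
     (15, ![536, -272, -284, 420]),
     (17, ![504, 0, 0, 0]),
     (19, ![-1248, -1488, 1200, 576]),
     (23, ![344, 80, 132, 304])]]

/-- The vertex-facet incidences of the 24-cell. -/
def incident (v F : Fin 24) : Bool := (incidenceMask v).testBit F

theorem dot_of_incident (v F : Fin 24) (h : incident v F = true) :
    ∑ k, vertexConst v k * normalConst F k = 2 ∧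
    ∑ k, (vertexConst v k * normalSlope F k + vertexSlope v k * normalConst F k) = 1 ∧
    ∑ k, vertexSlope v k * normalSlope F k = 0 := by
  revert v F; decide +kernel

/-- The second inequality is four times a lower bound for `(2 - p) + (1 - q) * a - r * a ^ 2` on `0
≤ a ≤ 1/2`, where `p`, `q`, `r` are the three sums: negative coefficients are charged at `a = 1/2`,
positive ones at `a = 0`. -/
theorem dot_of_not_incident (v F : Fin 24) (h : ¬ incident v F = true) :
    ∑ k, vertexConst v k * normalConst F k ≤ 1 ∧
    0 < 4 * (2 - ∑ k, vertexConst v k * normalConst F k) +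
      2 * min (1 - ∑ k, (vertexConst v k * normalSlope F k + vertexSlope v k * normalConst F k)) 0 +
      min (- ∑ k, vertexSlope v k * normalSlope F k) 0 := by
  revert v F; decide +kernel

theorem card_incident :
    (Finset.univ.filter fun p : Fin 24 × Fin 24 => incident p.1 p.2 = true).card = 144 := by
  decide +kernel

theorem exists_vertexConst (i j : Fin 4) (hij : i < j) (s t : Bool) :
    ∃ v, ∀ k, vertexConst v k = (if k = i then (if s then 1 else -1) else 0) +
      (if k = j then (if t then 1 else -1) else 0) := by
  revert i j s t; decide +kernel

theorem vertexConst_eq (v : Fin 24) : ∃ i j : Fin 4, i < j ∧ ∃ s t : Bool,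
    ∀ k, vertexConst v k = (if k = i then (if s then 1 else -1) else 0) +
      (if k = j then (if t then 1 else -1) else 0) := by
  revert v; decide +kernel

theorem exists_normalConst_single (k : Fin 4) (s : Bool) :
    ∃ F, ∀ m, normalConst F m = if m = k then (if s then 2 else -2) else 0 := by
  revert k s; decide +kernel

theorem exists_normalConst_signs (s : Fin 4 → Bool) :
    ∃ F, ∀ m, normalConst F m = if s m then 1 else -1 := by
  revert s; decide +kernel

set_option synthInstance.maxSize 1000 in
set_option synthInstance.maxHeartbeats 200000 in
/-- Every facet has four vertices that are affinely independent, because of their incidences. -/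
theorem exists_facet_flag (F : Fin 24) :
    ∃ w₀, incident w₀ F ∧ ∃ w₁ < w₀, incident w₁ F ∧ ∃ w₂ < w₁, incident w₂ F ∧
    ∃ w₃, incident w₃ F ∧
    (∃ K, ¬ incident w₀ K ∧ incident w₁ K ∧ incident w₂ K ∧ incident w₃ K) ∧
    (∃ K, ¬ incident w₁ K ∧ incident w₂ K ∧ incident w₃ K) ∧
    (∃ K, ¬ incident w₂ K ∧ incident w₃ K) := by
  revert F; decide +kernel

/-- Facets with the least angle have three common vertices that are affinely independent, because
of their incidences. -/
theorem exists_ridge_flag (F G : Fin 24) (h : ∑ k, normalConst F k * normalConst G k = 2) :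
    ∃ w₀, incident w₀ F ∧ incident w₀ G ∧ ∃ w₁ < w₀, incident w₁ F ∧ incident w₁ G ∧
    ∃ w₂ < w₁, incident w₂ F ∧ incident w₂ G ∧
    (∃ K, ¬ incident w₀ K ∧ incident w₁ K ∧ incident w₂ K) ∧
    (∃ K, ¬ incident w₁ K ∧ incident w₂ K) := by
  revert F G; decide +kernel

/-- The functional `v + u` thus exposes the segment from `v` to `u`. -/
theorem vertices_of_edge (v u w : Fin 24) (h : ∑ k, vertexConst v k * vertexConst u k = 1) :
    ∑ k, (vertexConst v k + vertexConst u k) * vertexConst w k ≤ 3 ∧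
    (∑ k, (vertexConst v k + vertexConst u k) * vertexConst w k = 3 ↔ w = v ∨ w = u) := by
  revert v u w; decide +kernel

theorem vertexConst_dotProduct (v u : Fin 24) :
    ∑ k, vertexConst v k * vertexConst u k ≤ 2 ∧
    (∑ k, vertexConst v k * vertexConst u k = 2 ↔ u = v) := by
  revert v u; decide +kernel

theorem normalConst_dotProduct_self (F : Fin 24) :
    ∑ k, normalConst F k * normalConst F k ≠ 2 := by
  revert F; decide +kernel

theorem exists_incident_not_incident (F G : Fin 24) (h : F ≠ G) :
    ∃ v, incident v F ∧ ¬ incident v G := by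
  revert F G; decide +kernel

theorem vertexConst_injective : Function.Injective vertexConst := by
  intro v w
  revert v w; decide +kernel

theorem vertexPos_injective : Function.Injective vertexPos := by
  intro v w
  revert v w; decide +kernel

theorem facetPos_injective : Function.Injective facetPos := by
  intro v w
  revert v w; decide +kernel

theorem vertexPos_ne_facetPos (v F : Fin 24) : vertexPos v ≠ facetPos F := by
  revert v F; decide +kernel

theorem vertexPos_le (v : Fin 24) : (v = 0 ∨ v = 8) ∧ vertexPos v ≤ 3 ∨
    (v ≠ 0 ∧ v ≠ 8) ∧ 3 < vertexPos v := by
  revert v; decide +kernel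

theorem facetPos_le (F : Fin 24) : (F = 0 ∨ F = 8) ∧ facetPos F ≤ 3 ∨
    (F ≠ 0 ∧ F ≠ 8) ∧ 3 < facetPos F := by
  revert F; decide +kernel

theorem exists_edge_before (H : Fin 24) (h0 : H ≠ 0) (h8 : H ≠ 8) :
    ∃ p q, ∑ k, vertexConst p k * vertexConst q k = 1 ∧ incident p H ∧ incident q H ∧
      vertexPos p < facetPos H ∧ vertexPos q < facetPos H := by
  revert H; decide +kernel

theorem exists_ridge_before (w : Fin 24) (h0 : w ≠ 0) (h8 : w ≠ 8) :
    ∃ H K, ∑ k, normalConst H k * normalConst K k = 2 ∧ incident w H ∧ incident w K ∧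
      facetPos H < vertexPos w ∧ facetPos K < vertexPos w := by
  revert w; decide +kernel

/-- The four incidences between the first two vertices and the first two facets. -/
def deleted (v F : Fin 24) : Bool := (v = 0 || v = 8) && (F = 0 || F = 8)

theorem card_later_facets (v : Fin 24) :
    (Finset.univ.filter fun F => incident v F ∧ ¬ deleted v F ∧
      vertexPos v < facetPos F).card ≤ 4 := by
  revert v; decide +kernel

theorem card_later_vertices (F : Fin 24) :
    (Finset.univ.filter fun v => incident v F ∧ ¬ deleted v F ∧
      facetPos F < vertexPos v).card ≤ 4 := by
  revert F; decide +kernel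

theorem card_remaining :
    (Finset.univ.filter fun p : Fin 24 × Fin 24 => incident p.1 p.2 = true ∧
      ¬ deleted p.1 p.2).card = 140 := by
  decide +kernel

/-- Checks a list of elimination steps, where the incidences in `done` are already eliminated.
The step `(true, v, F, K)` eliminates the incidence of `v` and `F` with the vertex `K`, the step
`(false, F, v, K)` with the facet `K`. -/
def checkSteps : List (Fin 24 × Fin 24) → List (Bool × Fin 24 × Fin 24 × Fin 24) → Bool
  | done, [] => decide (∀ v F, incident v F = true → (v, F) ∈ done)
  | done, (true, v, F, K) :: l => !(incident K F) &&
      decide (∀ G, incident v G = true → G = F ∨ incident K G = true ∨ (v, G) ∈ done) &&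
      checkSteps ((v, F) :: done) l
  | done, (false, F, v, K) :: l => !(incident v K) &&
      decide (∀ w, incident w F = true → w = v ∨ incident w K = true ∨ (w, F) ∈ done) &&
      checkSteps ((v, F) :: done) l

/-- The list visits the nodes by increasing position and eliminates, at each, the incidences with
later neighbours. The four deleted incidences are granted at the start. -/
theorem checkSteps_eliminationSteps :
    checkSteps [(0, 0), (0, 8), (8, 0), (8, 8)] eliminationSteps = true := by
  decide +kernel

/-- Looks up a vector in a list. -/
def dirOf (l : List (Fin 24 × (Fin 4 → ℤ))) (v : Fin 24) : Fin 4 → ℤ := (l.lookup v).getD 0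

/-- The change of the equation for an incidence along a direction. -/
def incidenceChange (i : Fin 4) (v F : Fin 24) : ℤ :=
  ∑ k, (2 * dirOf (vertexDir i) v k * (2 * normalConst F k + normalSlope F k) +
    5 * (2 * vertexConst v k + vertexSlope v k) * dirOf (normalDir i) F k)

theorem incidenceChange_eq_zero (i : Fin 4) (v F : Fin 24) (h : incident v F = true)
    (hd : ¬ deleted v F = true) : incidenceChange i v F = 0 := by
  revert i v F; decide +kernel

/-- The incidences between the first two vertices and the first two facets are independent. -/
theorem incidenceChange_deleted :
    (fun i j => incidenceChange i (![0, 0, 8, 8] j) (![0, 8, 0, 8] j)) =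
    ![![7250, -4700, 10750, 26300], ![5000, -2400, 8250, 20500],
      ![-2000, 27400, 6250, -35100], ![35000, 69800, 500, -23400]] := by
  decide +kernel

/-! ### Exposed faces and affine dimension -/

/-- A linear functional exposes the convex hull of the points at which it is maximal. -/
theorem isExposed_convexHull_image {d : ℕ} {ι : Type} [Fintype ι] {V : ι → Fin d → ℝ}
    {l : Fin d → ℝ} {c : ℝ} (hl : ∀ v, l ⬝ᵥ V v ≤ c) :
    IsExposed ℝ (convexHull ℝ (Set.range V)) (convexHull ℝ (V '' {v | l ⬝ᵥ V v = c})) := by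
  intro hne
  obtain ⟨_, v₀, hv₀, -⟩ := convexHull_nonempty_iff.mp hne
  have hv₀ : l ⬝ᵥ V v₀ = c := hv₀
  refine ⟨dotDual l, Set.Subset.antisymm ?_ ?_⟩
  · intro x hx
    refine ⟨convexHull_mono (Set.image_subset_range _ _) hx, fun y hy => ?_⟩
    have hxc : x ∈ {x | dotDual l x = c} := by
      refine convexHull_min ?_ (convex_hyperplane (dotDual l).isLinear c) hx
      rintro _ ⟨v, hv, rfl⟩
      exact (dotDual_apply l (V v)).trans hv
    rw [show dotDual l x = c from hxc, dotDual_apply]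
    exact dotProduct_le_of_mem_convexHull hl hy
  · rintro x ⟨hx, hmax⟩
    have h1 := hmax (V v₀) (subset_convexHull ℝ _ ⟨v₀, rfl⟩)
    rw [dotDual_apply, dotDual_apply, hv₀] at h1
    have h2 := le_antisymm (dotProduct_le_of_mem_convexHull hl hx) h1
    obtain ⟨w, w0, w1, rfl⟩ := mem_convexHull_range_iff.mp hx
    rw [dotProduct_sum_smul] at h2
    rw [← Finset.sum_filter_of_ne (p := fun v => 0 < w v) fun v _ hv =>
      lt_of_le_of_ne (w0 v) fun h => hv (by rw [← h, zero_smul])]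
    refine (convex_convexHull ℝ _).sum_mem (fun v _ => w0 v) ?_ fun v hv =>
      subset_convexHull ℝ _ ⟨v, eq_of_sum_mul_eq w0 w1 hl h2 (Finset.mem_filter.mp hv).2, rfl⟩
    rw [Finset.sum_filter_of_ne fun v _ hv => lt_of_le_of_ne (w0 v) hv.symm, w1]

/-- Differences of points of `S` are annihilated by `m` independent functionals. -/
theorem affDim_add_le {d m : ℕ} {S : Set (Fin d → ℝ)} {a : Fin m → Fin d → ℝ}
    (ha : LinearIndependent ℝ a) (hS : ∀ y ∈ S, ∀ i, a i ⬝ᵥ y = 1) : affDim S + m ≤ d := by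
  have hle : vectorSpan ℝ S ≤ LinearMap.ker (Matrix.mulVecLin (Matrix.of a)) := by
    rw [vectorSpan_def, Submodule.span_le]
    rintro _ ⟨x, hx, y, hy, rfl⟩
    rw [SetLike.mem_coe, LinearMap.mem_ker]
    funext i
    change a i ⬝ᵥ (x - y) = 0
    rw [dotProduct_sub, hS x hx, hS y hy, sub_self]
  have h1 := Submodule.finrank_mono hle
  have h2 := LinearMap.finrank_range_add_finrank_ker (Matrix.mulVecLin (Matrix.of a))
  have h3 : (Matrix.of a).rank = Fintype.card (Fin m) := LinearIndependent.rank_matrix ha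
  rw [Matrix.rank] at h3
  rw [h3, Module.finrank_fintype_fun_eq_card, Fintype.card_fin, Fintype.card_fin] at h2
  unfold affDim
  omega

/-- The functions `b i ⬝ᵥ · - 1` have a triangular matrix of values at the points `p j`, with
nonzero diagonal, so the points are affinely independent. -/
theorem le_affDim {d m : ℕ} {S : Set (Fin d → ℝ)} {p b : Fin (m + 1) → Fin d → ℝ}
    (hp : ∀ i, p i ∈ S) (hb : ∀ i j, i < j → b i ⬝ᵥ p j = 1) (hb' : ∀ i, b i ⬝ᵥ p i ≠ 1) :
    m ≤ affDim S := by
  have hind : AffineIndependent ℝ p := by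
    rw [affineIndependent_iff_of_fintype]
    intro w hw h i
    rw [Finset.weightedVSub_eq_linear_combination _ hw] at h
    induction i using WellFoundedLT.induction with
    | ind i ih =>
    have h1 : ∑ j, w j * (b i ⬝ᵥ p j - 1) = 0 := by
      simp only [mul_sub, Finset.sum_sub_distrib, ← dotProduct_sum_smul, h, mul_one, hw]
      simp
    rw [Finset.sum_eq_single i] at h1
    · exact (mul_eq_zero.mp h1).resolve_right (sub_ne_zero.mpr (hb' i))
    · intro j _ hj
      rcases lt_or_gt_of_ne hj with hj | hj
      · rw [ih j hj, zero_mul]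
      · rw [hb i j hj, sub_self, mul_zero]
    · simp
  have h1 := hind.finrank_vectorSpan (n := m) (by simp)
  have h2 : vectorSpan ℝ (Set.range p) ≤ vectorSpan ℝ S :=
    vectorSpan_mono ℝ (by rintro _ ⟨i, rfl⟩; exact hp i)
  rw [← h1]
  exact Submodule.finrank_mono h2

theorem affDim_convexHull_pair {d : ℕ} {p q : Fin d → ℝ} (h : p ≠ q) :
    affDim (convexHull ℝ {p, q}) = 1 := by
  rw [affDim, ← direction_affineSpan, affineSpan_convexHull, direction_affineSpan, vectorSpan_pair_rev]
  exact finrank_span_singleton (vsub_ne_zero.mpr h.symm)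

theorem linearIndependent_pair_of_dotProduct_eq_one {d : ℕ} {a b z : Fin d → ℝ} (hab : a ≠ b)
    (ha : a ⬝ᵥ z = 1) (hb : b ⬝ᵥ z = 1) : LinearIndependent ℝ ![a, b] := by
  rw [LinearIndependent.pair_iff]
  intro s t h
  have h1 := congrArg (· ⬝ᵥ z) h
  simp only [add_dotProduct, smul_dotProduct, ha, hb, zero_dotProduct, smul_eq_mul, mul_one] at h1
  have ht : t = -s := by linarith
  rw [ht, neg_smul, ← sub_eq_add_neg, ← smul_sub] at h
  have hs := (smul_eq_zero.mp h).resolve_right (sub_ne_zero.mpr hab)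
  exact ⟨hs, by rw [ht, hs, neg_zero]⟩

/-! ### A one-parameter family of 24-cells -/

/-- The vertices of a one-parameter family of polytopes that contains the 24-cell. -/
noncomputable def familyVertex (a : ℝ) (v : Fin 24) : Fin 4 → ℝ :=
  fun k => vertexConst v k + a * vertexSlope v k

/-- The facet normals of a one-parameter family of polytopes that contains the 24-cell. -/
noncomputable def familyNormal (a : ℝ) (F : Fin 24) : Fin 4 → ℝ :=
  fun k => (normalConst F k + a * normalSlope F k) / (2 + a)

theorem familyNormal_dotProduct (a : ℝ) (v F : Fin 24) :
    familyNormal a F ⬝ᵥ familyVertex a v =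
      (((∑ k, vertexConst v k * normalConst F k : ℤ) : ℝ) +
        ((∑ k, (vertexConst v k * normalSlope F k + vertexSlope v k * normalConst F k) : ℤ) : ℝ) * a +
        ((∑ k, vertexSlope v k * normalSlope F k : ℤ) : ℝ) * a ^ 2) / (2 + a) := by
  simp only [dotProduct, familyNormal, familyVertex, Fin.sum_univ_four]
  push_cast
  ring

theorem familyNormal_dotProduct_of_incident {a : ℝ} (ha : 0 ≤ a) {v F : Fin 24}
    (h : incident v F = true) : familyNormal a F ⬝ᵥ familyVertex a v = 1 := by
  obtain ⟨h0, h1, h2⟩ := dot_of_incident v F h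
  rw [familyNormal_dotProduct, h0, h1, h2]
  push_cast
  rw [one_mul, zero_mul, add_zero]
  exact div_self (by positivity)

theorem familyNormal_dotProduct_of_not_incident {a : ℝ} (ha : 0 ≤ a) (ha' : a ≤ 1 / 2)
    {v F : Fin 24} (h : ¬ incident v F = true) : familyNormal a F ⬝ᵥ familyVertex a v < 1 := by
  obtain ⟨h0, h1⟩ := dot_of_not_incident v F h
  rw [familyNormal_dotProduct, div_lt_one (by positivity)]
  generalize ∑ k, vertexConst v k * normalConst F k = p at *
  generalize ∑ k, (vertexConst v k * normalSlope F k + vertexSlope v k * normalConst F k) = q at *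
  generalize ∑ k, vertexSlope v k * normalSlope F k = r at *
  have h2 : (0 : ℝ) < 4 * (2 - p) + 2 * min (1 - (q : ℝ)) 0 + min (-(r : ℝ)) 0 := by
    exact_mod_cast h1
  have h0 : (p : ℝ) ≤ 1 := by exact_mod_cast h0
  have e1 : (1 - (q : ℝ)) * a ≥ min (1 - (q : ℝ)) 0 / 2 := by
    rcases le_total (1 - (q : ℝ)) 0 with hq | hq
    · rw [min_eq_left hq]; nlinarith
    · rw [min_eq_right hq]; nlinarith
  have ha2 : a ^ 2 ≤ 1 / 4 := by nlinarith
  have e2 : (-(r : ℝ)) * a ^ 2 ≥ min (-(r : ℝ)) 0 / 4 := by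
    rcases le_total (-(r : ℝ)) 0 with hr | hr
    · rw [min_eq_left hr]; nlinarith
    · rw [min_eq_right hr]; nlinarith [sq_nonneg a]
  linarith

theorem cell24_eq : cell24 = convexHull ℝ (Set.range (familyVertex 0)) := by
  unfold cell24
  congr 1
  ext x
  constructor
  · rintro ⟨i, j, hij, s, t, hs, ht, rfl⟩
    obtain ⟨v, hv⟩ := exists_vertexConst i j hij (decide (s = 1)) (decide (t = 1))
    refine ⟨v, funext fun k => ?_⟩
    simp only [familyVertex, hv k, Pi.add_apply, Pi.single_apply]
    rcases hs with rfl | rfl <;> rcases ht with rfl | rfl <;> norm_num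
  · rintro ⟨v, rfl⟩
    obtain ⟨i, j, hij, s, t, hv⟩ := vertexConst_eq v
    refine ⟨i, j, hij, if s then 1 else -1, if t then 1 else -1, ?_, ?_, funext fun k => ?_⟩
    · cases s <;> simp
    · cases t <;> simp
    · simp only [familyVertex, hv k, Pi.add_apply, Pi.single_apply]
      push_cast
      ring

/-- Of the total weight 2 available to `y`, at most 1 can go to coordinate `i`; the rest earns at
most `|l j|` per unit. -/
theorem dotProduct_le_of_two_largest {l y : Fin 4 → ℝ} {i j : Fin 4} (hij : i ≠ j)
    (hi : ∀ k, |l k| ≤ |l i|) (hj : ∀ k, k ≠ i → |l k| ≤ |l j|) (hy : ∀ k, |y k| ≤ 1)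
    (hsum : ∑ k, |y k| ≤ 2) : l ⬝ᵥ y ≤ |l i| + |l j| := by
  have h1 : ∀ k, l k * y k ≤ |l j| * |y k| + if k = i then |l i| - |l j| else 0 := by
    intro k
    have h2 : l k * y k ≤ |l k| * |y k| := (le_abs_self _).trans (abs_mul _ _).le
    split_ifs with hk
    · subst hk
      nlinarith [hy k, hi j]
    · nlinarith [hj k hk, abs_nonneg (y k)]
  calc l ⬝ᵥ y = ∑ k, l k * y k := rfl
    _ ≤ ∑ k, (|l j| * |y k| + if k = i then |l i| - |l j| else 0) :=
        Finset.sum_le_sum fun k _ => h1 k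
    _ = |l j| * ∑ k, |y k| + (|l i| - |l j|) := by
        rw [Finset.sum_add_distrib, Finset.mul_sum]; simp
    _ ≤ |l i| + |l j| := by nlinarith [abs_nonneg (l j)]

theorem exists_vertex_dotProduct {i j : Fin 4} (hij : i ≠ j) (l : Fin 4 → ℝ) :
    ∃ v, l ⬝ᵥ familyVertex 0 v = |l i| + |l j| := by
  wlog h : i < j generalizing i j
  · obtain ⟨v, hv⟩ := this hij.symm (lt_of_le_of_ne (not_lt.mp h) hij.symm)
    exact ⟨v, by rw [hv, add_comm]⟩
  obtain ⟨v, hv⟩ := exists_vertexConst i j h (decide (0 ≤ l i)) (decide (0 ≤ l j))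
  refine ⟨v, ?_⟩
  have habs : ∀ k, l k * (if 0 ≤ l k then 1 else -1) = |l k| := fun k => by
    split_ifs with hk
    · rw [mul_one, abs_of_nonneg hk]
    · rw [abs_of_neg (not_le.mp hk)]; ring
  rw [← habs i, ← habs j]
  simp only [dotProduct, familyVertex, hv]
  push_cast
  simp [mul_add, Finset.sum_add_distrib]

/-- The inequalities say `|y k| ≤ 1` and `∑ |y k| ≤ 2`. There a functional is bounded by the sum of
its two largest absolute coefficients, and some vertex attains this value, so no such point can be
separated from the hull. -/
theorem realizes_zero : Realizes (familyVertex 0) (familyNormal 0) fun v F => incident v F := by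
  have hle : ∀ v F, familyNormal 0 F ⬝ᵥ familyVertex 0 v ≤ 1 := fun v F => by
    by_cases h : incident v F
    · exact (familyNormal_dotProduct_of_incident le_rfl h).le
    · exact (familyNormal_dotProduct_of_not_incident le_rfl (by norm_num) h).le
  refine ⟨Set.Subset.antisymm ?_ ?_, fun v F => ⟨fun h => ?_,
    familyNormal_dotProduct_of_incident le_rfl⟩⟩
  · intro y hy F
    exact dotProduct_le_of_mem_convexHull (fun v => hle v F) hy
  · intro y hy
    by_contra hyQ
    obtain ⟨l, u, hl, hu⟩ := exists_dotProduct_lt_of_notMem_convexHull hyQ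
    obtain ⟨i, -, hi⟩ := Finset.exists_max_image Finset.univ (fun k => |l k|) ⟨0, Finset.mem_univ _⟩
    obtain ⟨j, hji, hj⟩ := Finset.exists_max_image (Finset.univ.erase i) (fun k => |l k|)
      (Finset.card_pos.mp (by simp))
    have hij : i ≠ j := (Finset.ne_of_mem_erase hji).symm
    obtain ⟨v, hv⟩ := exists_vertex_dotProduct hij l
    have hy1 : ∀ k, |y k| ≤ 1 := by
      intro k
      have aux : ∀ s : Bool, (if s then 1 else -1) * y k ≤ 1 := by
        intro s
        obtain ⟨F, hF⟩ := exists_normalConst_single k s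
        have := hy F
        simp only [dotProduct, familyNormal, hF] at this
        cases s <;> simp [ite_div, ite_mul] at this ⊢ <;> linarith
      have e1 := aux true
      have e2 := aux false
      simp at e1 e2
      exact abs_le.mpr ⟨by linarith, e1⟩
    have hy2 : ∑ k, |y k| ≤ 2 := by
      obtain ⟨F, hF⟩ := exists_normalConst_signs fun k => decide (0 ≤ y k)
      have := hy F
      have habs : ∀ k, (if 0 ≤ y k then 1 else -1) * y k = |y k| := fun k => by
        split_ifs with hk
        · rw [one_mul, abs_of_nonneg hk]
        · rw [abs_of_neg (not_le.mp hk)]; ring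
      have h2 : familyNormal 0 F ⬝ᵥ y = (∑ k, |y k|) / 2 := by
        simp only [dotProduct, familyNormal, hF, ← habs, Finset.sum_div]
        refine Finset.sum_congr rfl fun k _ => ?_
        push_cast
        simp only [decide_eq_true_eq]
        ring
      rw [h2] at this
      linarith
    have := dotProduct_le_of_two_largest hij (fun k => hi k (Finset.mem_univ k))
      (fun k hk => hj k (Finset.mem_erase.mpr ⟨hk, Finset.mem_univ k⟩)) hy1 hy2
    linarith [hl v]
  · by_contra hc
    exact (familyNormal_dotProduct_of_not_incident le_rfl (by norm_num) hc).ne h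

/-- The incidence equations hold along the whole family and the other pairs stay strict up to `1/2`,
so connectedness carries the realization over from `a = 0`. -/
theorem realizes_half :
    Realizes (familyVertex (1 / 2)) (familyNormal (1 / 2)) fun v F => incident v F := by
  have : PreconnectedSpace (Set.Icc (0 : ℝ) (1 / 2)) :=
    Subtype.preconnectedSpace isPreconnected_Icc
  have h0 : (0 : ℝ) ∈ Set.Icc (0 : ℝ) (1 / 2) := ⟨le_rfl, by norm_num⟩
  refine Realizes.of_preconnectedSpace (X := Set.Icc (0 : ℝ) (1 / 2))
    (V := fun a => familyVertex a) (A := fun a => familyNormal a) (x₀ := ⟨0, h0⟩)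
    (fun v => ?_) (fun F => ?_) (fun a v F h => familyNormal_dotProduct_of_incident a.2.1 h)
    (fun a v F h => familyNormal_dotProduct_of_not_incident a.2.1 a.2.2 h) realizes_zero
    ⟨1 / 2, by norm_num, le_rfl⟩
  · unfold familyVertex
    fun_prop
  · unfold familyNormal
    refine continuous_pi fun k => Continuous.div (by fun_prop) (by fun_prop) fun a => ?_
    have := a.2.1
    positivity

/-! ### Vertices, facets, edges and ridges of the 24-cell -/

namespace Realizes

variable {d : ℕ} {ι κ : Type} [Fintype ι] {inc : ι → κ → Prop}
  {V : ι → Fin d → ℝ} {A : κ → Fin d → ℝ}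

theorem exists_eq_vertex [Fintype κ] [Nonempty κ] (h : Realizes V A inc) {y : Fin d → ℝ}
    (hy : IsExposed ℝ (convexHull ℝ (Set.range V)) {y}) : ∃ v, V v = y := by
  obtain ⟨w, h0, h1, hw⟩ := mem_convexHull_range_iff.mp (hy.subset rfl)
  obtain ⟨v, hv⟩ := exists_pos_of_sum_eq_one h1
  exact ⟨v, h.vertex_mem_face hy h0 h1 hw hv⟩

/-- Such a face satisfies some facet equation, since otherwise it would be the whole polytope. It
satisfies only one, since two distinct normals would lower its dimension by two. -/
theorem exists_eq_facet [Fintype κ] [Nonempty κ] (h : Realizes V A inc)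
    (hinj : Function.Injective A) (hfull : d ≤ affDim (convexHull ℝ (Set.range V)))
    {S : Set (Fin d → ℝ)} (hS : IsExposed ℝ (convexHull ℝ (Set.range V)) S) (hne : S.Nonempty)
    (hdim : affDim S + 1 = d) : ∃ F, {y ∈ convexHull ℝ (Set.range V) | A F ⬝ᵥ y = 1} = S := by
  obtain ⟨z, hz⟩ := hne
  have hex : ∃ F, ∀ v, V v ∈ S → inc v F := by
    by_contra hF
    have : S = convexHull ℝ (Set.range V) := by
      ext y
      rw [h.mem_face_iff hS]
      exact ⟨fun hy => hy.1, fun hy => ⟨hy, fun F hF' => absurd ⟨F, hF'⟩ hF⟩⟩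
    rw [this] at hdim
    omega
  obtain ⟨F, hF⟩ := hex
  refine ⟨F, ?_⟩
  have huniq : ∀ G, (∀ v, V v ∈ S → inc v G) → G = F := by
    intro G hG
    by_contra hGF
    have hd : ∀ y ∈ S, ∀ i, ![A G, A F] i ⬝ᵥ y = 1 := by
      intro y hy i
      rw [h.mem_face_iff hS] at hy
      fin_cases i
      · exact hy.2 G hG
      · exact hy.2 F hF
    have := affDim_add_le (linearIndependent_pair_of_dotProduct_eq_one (hinj.ne hGF)
      (hd z hz 0) (hd z hz 1)) hd
    omega
  ext y
  rw [h.mem_face_iff hS]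
  exact ⟨fun hy => ⟨hy.1, fun G hG => huniq G hG ▸ hy.2⟩, fun hy => ⟨hy.1, hy.2 F hF⟩⟩

omit [Fintype ι] in
theorem comp_equiv {ι' κ' : Type} {inc' : ι' → κ' → Prop} (e : ι' ≃ ι) (f : κ' ≃ κ)
    (h : Realizes V A inc) (hinc : ∀ v F, inc' v F ↔ inc (e v) (f F)) :
    Realizes (V ∘ e) (A ∘ f) inc' := by
  refine ⟨?_, fun v F => (h.incident _ _).trans (hinc v F).symm⟩
  rw [e.surjective.range_comp, h.hull]
  ext y
  exact (f.forall_congr_right (q := fun F => A F ⬝ᵥ y ≤ 1)).symm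

end Realizes

theorem familyVertex_zero_dotProduct (v u : Fin 24) :
    familyVertex 0 v ⬝ᵥ familyVertex 0 u = ((∑ k, vertexConst v k * vertexConst u k : ℤ) : ℝ) := by
  simp [dotProduct, familyVertex]

theorem familyVertex_zero_injective : Function.Injective (familyVertex 0) := by
  intro v u h
  refine vertexConst_injective (funext fun k => ?_)
  have := congrFun h k
  simpa [familyVertex] using this

theorem familyNormal_zero_injective : Function.Injective (familyNormal 0) := by
  intro F G h
  by_contra hne
  obtain ⟨v, h1, h2⟩ := exists_incident_not_incident F G hne
  rw [← realizes_zero.incident] at h1 h2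
  exact h2 (h ▸ h1)

theorem isExposed_cell24_vertex (v : Fin 24) : IsExposed ℝ cell24 {familyVertex 0 v} := by
  have h := isExposed_convexHull_image (V := familyVertex 0) (l := familyVertex 0 v) (c := 2)
    fun u => by
      rw [familyVertex_zero_dotProduct]
      exact_mod_cast (vertexConst_dotProduct v u).1
  rw [cell24_eq]
  convert h
  rw [show {u | familyVertex 0 v ⬝ᵥ familyVertex 0 u = 2} = {v} from ?_, Set.image_singleton,
    convexHull_singleton]
  ext u
  rw [Set.mem_ofPred_eq, familyVertex_zero_dotProduct, Set.mem_singleton_iff,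
    ← (vertexConst_dotProduct v u).2]
  norm_cast

/-- The facets of the 24-cell. -/
def cellFacet (F : Fin 24) : Set (Fin 4 → ℝ) := {y ∈ cell24 | familyNormal 0 F ⬝ᵥ y = 1}

theorem familyVertex_mem_cell24 (v : Fin 24) : familyVertex 0 v ∈ cell24 :=
  cell24_eq ▸ subset_convexHull ℝ _ ⟨v, rfl⟩

theorem familyVertex_mem_cellFacet {v F : Fin 24} :
    familyVertex 0 v ∈ cellFacet F ↔ incident v F = true :=
  (and_iff_right (familyVertex_mem_cell24 v)).trans (realizes_zero.incident v F)

theorem isExposed_cellFacet (F : Fin 24) : IsExposed ℝ cell24 (cellFacet F) := by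
  unfold cellFacet
  rw [cell24_eq]
  simpa using realizes_zero.isExposed_of_facets (· = F)

theorem familyNormal_ne_one {v F : Fin 24} (h : ¬ incident v F = true) :
    familyNormal 0 F ⬝ᵥ familyVertex 0 v ≠ 1 := fun hc => h ((realizes_zero.incident v F).mp hc)

theorem three_le_affDim_and {F : Fin 24} :
    3 ≤ affDim (cellFacet F) ∧ ((∃ v, ¬ incident v F = true) → 4 ≤ affDim cell24) := by
  obtain ⟨w₀, i₀, w₁, -, i₁, w₂, -, i₂, w₃, i₃, ⟨K₀, k₀, k₀₁, k₀₂, k₀₃⟩, ⟨K₁, k₁, k₁₂, k₁₃⟩,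
    K₂, k₂, k₂₃⟩ := exists_facet_flag F
  have hi {v F} := (realizes_zero.incident v F).mpr
  constructor
  · refine le_affDim (p := fun i => familyVertex 0 (![w₀, w₁, w₂, w₃] i))
      -- The last point needs only a functional with value different from 1 there, so zero serves.
      (b := ![familyNormal 0 K₀, familyNormal 0 K₁, familyNormal 0 K₂, 0]) ?_ ?_ ?_
    · simp [Fin.forall_fin_succ, familyVertex_mem_cellFacet, *]
    · simp [Fin.forall_fin_succ, *]
    · simp [Fin.forall_fin_succ, familyNormal_ne_one, *]
  · rintro ⟨v, hv⟩
    refine le_affDim (p := fun i => familyVertex 0 (![v, w₀, w₁, w₂, w₃] i))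
      (b := ![familyNormal 0 F, familyNormal 0 K₀, familyNormal 0 K₁, familyNormal 0 K₂, 0]) ?_ ?_ ?_
    · simp [familyVertex_mem_cell24]
    · simp [Fin.forall_fin_succ, *]
    · simp [Fin.forall_fin_succ, familyNormal_ne_one, *]

theorem affDim_cellFacet (F : Fin 24) : affDim (cellFacet F) + 1 = 4 := by
  obtain ⟨w, i, -⟩ := exists_facet_flag F
  have h : ∀ y ∈ cellFacet F, ∀ i, ![familyNormal 0 F] i ⬝ᵥ y = 1 := fun y hy i => by
    fin_cases i
    exact hy.2
  have h1 := affDim_add_le (a := ![familyNormal 0 F]) (.of_subsingleton 0 fun h0 => by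
    have := h _ (familyVertex_mem_cellFacet.mpr i) 0
    erw [h0] at this
    simp at this) h
  have := (three_le_affDim_and (F := F)).1
  omega

/-- The labels of the vertices of the 24-cell. -/
noncomputable def vertexEquiv : Fin 24 ≃ Vertex cell24 :=
  Equiv.ofBijective (fun v => ⟨familyVertex 0 v, isExposed_cell24_vertex v⟩)
    ⟨fun _ _ h => familyVertex_zero_injective (congrArg Subtype.val h), fun ⟨y, hy⟩ => by
      rw [cell24_eq] at hy
      obtain ⟨v, rfl⟩ := realizes_zero.exists_eq_vertex hy
      exact ⟨v, rfl⟩⟩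

/-- The labels of the facets of the 24-cell. -/
noncomputable def facetEquiv : Fin 24 ≃ Facet cell24 :=
  Equiv.ofBijective (fun F => ⟨⟨cellFacet F, isExposed_cellFacet F⟩,
      by
        obtain ⟨w, i, -⟩ := exists_facet_flag F
        exact ⟨_, familyVertex_mem_cellFacet.mpr i⟩, affDim_cellFacet F⟩)
    ⟨fun F G h => by
      by_contra hne
      obtain ⟨v, h1, h2⟩ := exists_incident_not_incident F G hne
      rw [← familyVertex_mem_cellFacet] at h1 h2
      have h : cellFacet F = cellFacet G := congrArg Facet.pts h
      exact h2 (h ▸ h1), fun ⟨⟨S, hS⟩, hne, hdim⟩ => by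
      -- Vertex 1 is off facet 0, so the cell is full-dimensional.
      have hfull := (three_le_affDim_and (F := 0)).2 ⟨1, by decide⟩
      have hS' := hS
      rw [cell24_eq] at hS' hfull
      obtain ⟨F, hF⟩ := realizes_zero.exists_eq_facet familyNormal_zero_injective hfull hS' hne hdim
      refine ⟨F, Subtype.ext (Subtype.ext ?_)⟩
      rw [← cell24_eq] at hF
      exact hF⟩

theorem vertexEquiv_mem_facetEquiv {v F : Fin 24} :
    (vertexEquiv v).1 ∈ (facetEquiv F).pts ↔ incident v F = true :=
  familyVertex_mem_cellFacet

theorem mem_facet_iff {v : Vertex cell24} {F : Facet cell24} :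
    v.1 ∈ F.pts ↔ incident (vertexEquiv.symm v) (facetEquiv.symm F) = true := by
  rw [← vertexEquiv_mem_facetEquiv, Equiv.apply_symm_apply, Equiv.apply_symm_apply]

noncomputable instance : Fintype (Vertex cell24) := Fintype.ofEquiv _ vertexEquiv

noncomputable instance : Fintype (Facet cell24) := Fintype.ofEquiv _ facetEquiv

instance : Nonempty (Facet cell24) := ⟨facetEquiv 0⟩

theorem card_vertex : Fintype.card (Vertex cell24) = 24 :=
  (Fintype.card_congr vertexEquiv.symm).trans (Fintype.card_fin 24)

theorem card_facet : Fintype.card (Facet cell24) = 24 :=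
  (Fintype.card_congr facetEquiv.symm).trans (Fintype.card_fin 24)

theorem familyVertex_comp_symm :
    familyVertex 0 ∘ vertexEquiv.symm = fun v : Vertex cell24 => v.1 :=
  funext fun v => congrArg Subtype.val (vertexEquiv.apply_symm_apply v)

theorem mem_centeredRealizationSpace_cell24_iff (x : Coord cell24 → ℝ) :
    x ∈ centeredRealizationSpace cell24 ↔
      Realizes (vcol x) (acol x) fun v F => v.1 ∈ F.pts := by
  refine mem_centeredRealizationSpace_iff (A₀ := familyNormal 0 ∘ facetEquiv.symm) ?_ ?_ x
  · rw [← familyVertex_comp_symm, vertexEquiv.symm.surjective.range_comp, cell24_eq]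
  · rw [← familyVertex_comp_symm]
    exact realizes_zero.comp_equiv vertexEquiv.symm facetEquiv.symm fun v F => mem_facet_iff

theorem formEdge_vertexEquiv {v u : Fin 24} (h : ∑ k, vertexConst v k * vertexConst u k = 1) :
    FormEdge (vertexEquiv v) (vertexEquiv u) := by
  have hdot : ∀ w, (familyVertex 0 v + familyVertex 0 u) ⬝ᵥ familyVertex 0 w =
      ((∑ k, (vertexConst v k + vertexConst u k) * vertexConst w k : ℤ) : ℝ) := fun w => by
    simp [dotProduct, familyVertex]
  have hne : v ≠ u := by
    rintro rfl
    have := (vertexConst_dotProduct v v).2.mpr rfl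
    omega
  have hexp := isExposed_convexHull_image (V := familyVertex 0)
    (l := familyVertex 0 v + familyVertex 0 u) (c := 3) fun w => by
      rw [hdot]
      exact_mod_cast (vertices_of_edge v u w h).1
  rw [show {w | (familyVertex 0 v + familyVertex 0 u) ⬝ᵥ familyVertex 0 w = 3} = {v, u} from ?_,
    Set.image_pair, ← cell24_eq] at hexp
  · refine ⟨vertexEquiv.injective.ne hne, ⟨_, hexp⟩,
      affDim_convexHull_pair (familyVertex_zero_injective.ne hne), ?_, ?_⟩
    · exact subset_convexHull ℝ _ (Set.mem_insert _ _)
    · exact subset_convexHull ℝ _ (Set.mem_insert_of_mem _ rfl)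
  · ext w
    rw [Set.mem_ofPred_eq, hdot, Set.mem_insert_iff, Set.mem_singleton_iff,
      ← (vertices_of_edge v u w h).2]
    norm_cast

/-- Three affinely independent common vertices bound the dimension from below, the two independent
normals from above. -/
theorem formRidge_facetEquiv {F G : Fin 24} (h : ∑ k, normalConst F k * normalConst G k = 2) :
    FormRidge (facetEquiv F) (facetEquiv G) := by
  have hne : F ≠ G := by
    rintro rfl
    exact normalConst_dotProduct_self F h
  obtain ⟨w₀, i₀, j₀, w₁, -, i₁, j₁, w₂, -, i₂, j₂, ⟨K₀, k₀, k₀₁, k₀₂⟩, K₁, k₁, k₁₂⟩ :=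
    exists_ridge_flag F G h
  have hi {v F} := (realizes_zero.incident v F).mpr
  have h1 : 2 ≤ affDim (cellFacet F ∩ cellFacet G) := by
    refine le_affDim (p := fun i => familyVertex 0 (![w₀, w₁, w₂] i))
      (b := ![familyNormal 0 K₀, familyNormal 0 K₁, 0]) ?_ ?_ ?_
    · simp [Fin.forall_fin_succ, familyVertex_mem_cellFacet, *]
    · simp [Fin.forall_fin_succ, *]
    · simp [Fin.forall_fin_succ, familyNormal_ne_one, *]
  have h2 := affDim_add_le (S := cellFacet F ∩ cellFacet G)
    (linearIndependent_pair_of_dotProduct_eq_one (familyNormal_zero_injective.ne hne)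
      (hi i₀) (hi j₀)) fun y hy i => by
      fin_cases i
      · exact hy.1.2
      · exact hy.2.2
  refine ⟨facetEquiv.injective.ne hne, ⟨familyVertex 0 w₀, familyVertex_mem_cellFacet.mpr i₀,
    familyVertex_mem_cellFacet.mpr j₀⟩, ?_⟩
  change affDim (cellFacet F ∩ cellFacet G) + 2 = 4
  omega

/-! ### The Jacobian matrix and stresses -/

section Jacobian

variable {d : ℕ} {P : Set (Fin d → ℝ)} (x : Coord P → ℝ) (e : Incidence P)

theorem eval_charMap :
    MvPolynomial.eval x (charMap P e) = acol x e.facet ⬝ᵥ vcol x e.vertex - 1 := by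
  simp [charMap, dotProduct, acol, vcol, mul_comm]

open Classical in
theorem jacobian_inl (v : Vertex P) (k : Fin d) :
    jacobian P x e (Sum.inl v, k) = if e.vertex = v then acol x e.facet k else 0 := by
  simp only [jacobian, charMap, map_sub, map_sum, Derivation.leibniz, MvPolynomial.pderiv_X,
    Pi.single_apply, Prod.mk.injEq, Sum.inl.injEq, reduceCtorEq, false_and, if_false, smul_eq_mul,
    mul_zero, zero_add, MvPolynomial.pderiv_one, sub_zero, map_mul,
    MvPolynomial.eval_X, acol]
  split_ifs with h <;> simp [h, apply_ite]

open Classical in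
theorem jacobian_inr (F : Facet P) (k : Fin d) :
    jacobian P x e (Sum.inr F, k) = if e.facet = F then vcol x e.vertex k else 0 := by
  simp only [jacobian, charMap, map_sub, map_sum, Derivation.leibniz, MvPolynomial.pderiv_X,
    Pi.single_apply, Prod.mk.injEq, Sum.inr.injEq, reduceCtorEq, false_and, if_false, smul_eq_mul,
    mul_zero, add_zero, MvPolynomial.pderiv_one, sub_zero, map_mul,
    MvPolynomial.eval_X, vcol]
  split_ifs with h <;> simp [h, apply_ite]

theorem Incidence.ends_injective :
    Function.Injective fun e : Incidence P => (e.vertex, e.facet) :=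
  fun _ _ h => Subtype.ext h

/-- The rows of the Jacobian matrix are linearly independent if there is no nontrivial stress on the
incidences. -/
theorem linearIndependent_jacobian [Fintype (Vertex P)] [Fintype (Facet P)] (s : Set (Incidence P))
    (h : ∀ C : Vertex P → Facet P → ℝ, (∀ v F, C v F ≠ 0 → ∃ e ∈ s, e.vertex = v ∧ e.facet = F) →
      (∀ v, ∑ F, C v F • acol x F = 0) → (∀ F, ∑ v, C v F • vcol x v = 0) → ∀ v F, C v F = 0) :
    LinearIndependent ℝ fun e : s => jacobian P x e.1 := by
  classical
  let ends : s → Vertex P × Facet P := fun e => (e.1.vertex, e.1.facet)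
  have hends : Function.Injective ends :=
    Incidence.ends_injective.comp Subtype.val_injective
  have : Fintype s := Fintype.ofInjective ends hends
  rw [Fintype.linearIndependent_iff]
  intro g hg e
  let C : Vertex P × Facet P → ℝ := Function.extend ends g 0
  have hC : ∀ e, C (ends e) = g e := hends.extend_apply g 0
  have hC0 : ∀ p ∉ Set.range ends, C p = 0 := fun p hp => Function.extend_apply' _ _ _ hp
  have hsum : ∀ f : Vertex P × Facet P → ℝ, ∑ e, g e * f (ends e) = ∑ v, ∑ F, C (v, F) * f (v, F) :=
    fun f => by
      rw [← Fintype.sum_prod_type fun p => C p * f p]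
      exact Fintype.sum_of_injective ends hends _ _ (fun p hp => by rw [hC0 p hp, zero_mul])
        fun e => by rw [hC]
  rw [← hC e]
  refine h (fun v F => C (v, F)) (fun v F hvF => ?_) (fun v => ?_) (fun F => ?_) _ _
  · by_contra hne
    refine hvF (hC0 _ ?_)
    rintro ⟨e, he⟩
    exact hne ⟨e.1, e.2, congrArg Prod.fst he, congrArg Prod.snd he⟩
  · funext k
    have h1 := congrFun hg (Sum.inl v, k)
    simp only [Finset.sum_apply, Pi.smul_apply, smul_eq_mul, jacobian_inl] at h1
    rw [hsum fun p => if p.1 = v then acol x p.2 k else 0] at h1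
    simpa [Finset.sum_apply] using h1
  · funext k
    have h1 := congrFun hg (Sum.inr F, k)
    simp only [Finset.sum_apply, Pi.smul_apply, smul_eq_mul, jacobian_inr] at h1
    rw [hsum fun p => if p.2 = F then vcol x p.1 k else 0] at h1
    simpa [Finset.sum_apply] using h1

end Jacobian

/-- Pair the relation with `p - q`: every active normal other than `A F` has value 1 at both points
and drops out. -/
theorem eq_zero_of_sum_smul_eq_zero {d : ℕ} {κ : Type} [Fintype κ] {c : κ → ℝ}
    {A : κ → Fin d → ℝ} {p q : Fin d → ℝ} (h : ∑ G, c G • A G = 0) {F : κ}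
    (hp : ∀ G, c G ≠ 0 → A G ⬝ᵥ p = 1) (hq : ∀ G, c G ≠ 0 → G ≠ F → A G ⬝ᵥ q = 1)
    (hF : A F ⬝ᵥ q ≠ 1) : c F = 0 := by
  by_contra hc
  have h1 : ∑ G, c G * (A G ⬝ᵥ p - A G ⬝ᵥ q) = 0 := by
    have h2 := congrArg (fun y => (p - q) ⬝ᵥ y) h
    simp only [dotProduct_sum_smul, dotProduct_zero] at h2
    rw [← h2]
    exact Finset.sum_congr rfl fun G _ => by rw [dotProduct_comm (p - q), dotProduct_sub]
  rw [Finset.sum_eq_single F (fun G _ hG => ?_) fun hF => absurd (Finset.mem_univ F) hF] at h1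
  · rw [hp F hc] at h1
    exact hF (sub_eq_zero.mp ((mul_eq_zero.mp h1).resolve_left hc)).symm
  · by_cases hG0 : c G = 0
    · rw [hG0, zero_mul]
    · rw [hp G hG0, hq G hG0 hG, sub_self, mul_zero]

/-- A successful elimination shows that a stress is trivial. -/
theorem eq_zero_of_checkSteps {V A : Fin 24 → Fin 4 → ℝ} {C : Fin 24 → Fin 24 → ℝ}
    (hinc : ∀ v F, A F ⬝ᵥ V v = 1 ↔ incident v F = true) (h0 : ∀ v F, C v F ≠ 0 → incident v F = true)
    (hA : ∀ v, ∑ F, C v F • A F = 0) (hV : ∀ F, ∑ v, C v F • V v = 0)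
    (l : List (Bool × Fin 24 × Fin 24 × Fin 24)) (done : List (Fin 24 × Fin 24))
    (hl : checkSteps done l = true) (hdone : ∀ p ∈ done, C p.1 p.2 = 0) (v F : Fin 24) :
    C v F = 0 := by
  induction l generalizing done with
  | nil =>
    simp only [checkSteps, decide_eq_true_eq] at hl
    by_contra h
    exact h (hdone _ (hl v F (h0 v F h)))
  | cons s l ih =>
    obtain ⟨b, m, n, K⟩ := s
    cases b
    · simp only [checkSteps, Bool.and_eq_true, Bool.not_eq_true', decide_eq_true_eq] at hl
      obtain ⟨⟨h1, h2⟩, h3⟩ := hl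
      refine ih _ h3 (List.forall_mem_cons.mpr ⟨?_, hdone⟩)
      -- In a facet step, points and normals exchange roles.
      refine eq_zero_of_sum_smul_eq_zero (p := A m) (q := A K) (hV m) (fun w hw => ?_)
        (fun w hw hwn => ?_) ?_
      · rw [dotProduct_comm, hinc]
        exact h0 _ _ hw
      · rw [dotProduct_comm, hinc]
        rcases h2 w (h0 _ _ hw) with h | h | h
        · exact absurd h hwn
        · exact h
        · exact absurd (hdone _ h) hw
      · rw [dotProduct_comm, Ne, hinc, h1]
        exact Bool.false_ne_true
    · simp only [checkSteps, Bool.and_eq_true, Bool.not_eq_true', decide_eq_true_eq] at hl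
      obtain ⟨⟨h1, h2⟩, h3⟩ := hl
      refine ih _ h3 (List.forall_mem_cons.mpr ⟨?_, hdone⟩)
      refine eq_zero_of_sum_smul_eq_zero (p := V m) (q := V K) (hA m) (fun G hG => ?_)
        (fun G hG hGn => ?_) ?_
      · rw [hinc]
        exact h0 _ _ hG
      · rw [hinc]
        rcases h2 G (h0 _ _ hG) with h | h | h
        · exact absurd h hGn
        · exact h
        · exact absurd (hdone _ h) hG
      · rw [Ne, hinc, h1]
        exact Bool.false_ne_true

/-- A stress annihilates first-order changes of the incidence equations: the relations at the
vertices cancel the motion of the vertices, those at the facets the motion of the normals. -/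
theorem sum_mul_incidenceChange {C : Fin 24 → Fin 24 → ℝ}
    (hA : ∀ v, ∑ F, C v F • familyNormal (1 / 2) F = 0)
    (hV : ∀ F, ∑ v, C v F • familyVertex (1 / 2) v = 0) (i : Fin 4) :
    ∑ v, ∑ F, C v F * incidenceChange i v F = 0 := by
  -- At `a = 1/2` the vertices have denominator 2 and the normals denominator 5; the factor 10 makes
  -- the change integral.
  have h1 : ∀ v F, C v F * (incidenceChange i v F : ℝ) =
      10 * ((fun k => (dirOf (vertexDir i) v k : ℝ)) ⬝ᵥ (C v F • familyNormal (1 / 2) F)) +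
      10 * ((fun k => (dirOf (normalDir i) F k : ℝ)) ⬝ᵥ (C v F • familyVertex (1 / 2) v)) := by
    intro v F
    simp only [incidenceChange, dotProduct, familyNormal, familyVertex, Fin.sum_univ_four,
      Pi.smul_apply, smul_eq_mul]
    push_cast
    ring
  simp only [h1, Finset.sum_add_distrib, ← Finset.mul_sum]
  rw [Finset.sum_comm (f := fun v F =>
    (fun k => (dirOf (normalDir i) F k : ℝ)) ⬝ᵥ (C v F • familyVertex (1 / 2) v))]
  simp only [← dotProduct_sum, hA, hV, dotProduct_zero, Finset.sum_const_zero, mul_zero, add_zero]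

/-- Each of the four deformations changes only the deleted equations, so it gives one linear
equation in these four coefficients. The resulting 4 × 4 system is nonsingular. -/
theorem eq_zero_of_deleted {C : Fin 24 → Fin 24 → ℝ}
    (h0 : ∀ v F, C v F ≠ 0 → incident v F = true)
    (hA : ∀ v, ∑ F, C v F • familyNormal (1 / 2) F = 0)
    (hV : ∀ F, ∑ v, C v F • familyVertex (1 / 2) v = 0) :
    C 0 0 = 0 ∧ C 0 8 = 0 ∧ C 8 0 = 0 ∧ C 8 8 = 0 := by
  have h1 : ∀ i, C 0 0 * incidenceChange i 0 0 + C 0 8 * incidenceChange i 0 8 +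
      C 8 0 * incidenceChange i 8 0 + C 8 8 * incidenceChange i 8 8 = 0 := by
    intro i
    have h2 := sum_mul_incidenceChange hA hV i
    rw [← Fintype.sum_prod_type fun p : Fin 24 × Fin 24 => C p.1 p.2 * (incidenceChange i p.1 p.2 : ℝ),
      ← Finset.sum_subset (Finset.subset_univ {(0, 0), (0, 8), (8, 0), (8, 8)}) fun p _ hp => ?_] at h2
    · rw [← h2]
      simp [add_assoc]
    · by_cases hC : C p.1 p.2 = 0
      · rw [hC, zero_mul]
      · rw [incidenceChange_eq_zero i _ _ (h0 _ _ hC), Int.cast_zero, mul_zero]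
        obtain ⟨v, F⟩ := p
        intro hd
        simp only [deleted, Bool.and_eq_true, Bool.or_eq_true, decide_eq_true_eq] at hd
        rcases hd with ⟨rfl | rfl, rfl | rfl⟩ <;> simp at hp
  have hM : ∀ i j, incidenceChange i (![0, 0, 8, 8] j) (![0, 8, 0, 8] j) = _ :=
    fun i j => congrFun (congrFun incidenceChange_deleted i) j
  have hM' : ∀ i, _ ∧ _ ∧ _ ∧ _ := fun i => ⟨hM i 0, hM i 1, hM i 2, hM i 3⟩
  have e0 := h1 0
  have e1 := h1 1
  have e2 := h1 2
  have e3 := h1 3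
  simp only [Matrix.cons_val] at hM'
  simp only [hM', Matrix.cons_val] at e0 e1 e2 e3
  push_cast at e0 e1 e2 e3
  refine ⟨?_, ?_, ?_, ?_⟩ <;> linarith

/-! ### Labels of the incidences and the ordering -/

/-- The incidences of the 24-cell without the incidences between two vertices and two facets. -/
abbrev cellRemaining : Set (Incidence cell24) :=
  remaining (vertexEquiv 0) (vertexEquiv 8) (facetEquiv 0) (facetEquiv 8)

theorem mem_cellRemaining {e : Incidence cell24} : e ∈ cellRemaining ↔
    ¬ deleted (vertexEquiv.symm e.vertex) (facetEquiv.symm e.facet) = true := by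
  simp [cellRemaining, remaining, deleted, Equiv.symm_apply_eq]

theorem incident_of_incidence (e : Incidence cell24) :
    incident (vertexEquiv.symm e.vertex) (facetEquiv.symm e.facet) = true :=
  mem_facet_iff.mp e.2

/-- The labels of the vertex and the facet of an incidence. -/
noncomputable def incidenceLabel (e : Incidence cell24) : Fin 24 × Fin 24 :=
  (vertexEquiv.symm e.vertex, facetEquiv.symm e.facet)

theorem incidenceLabel_injective : Function.Injective incidenceLabel :=
  (vertexEquiv.symm.injective.prodMap facetEquiv.symm.injective).comp Incidence.ends_injective

theorem exists_incidenceLabel_eq {v F : Fin 24} (h : incident v F = true) :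
    ∃ e, incidenceLabel e = (v, F) :=
  ⟨⟨(vertexEquiv v, facetEquiv F), vertexEquiv_mem_facetEquiv.mpr h⟩,
    Prod.ext (vertexEquiv.symm_apply_apply v) (facetEquiv.symm_apply_apply F)⟩

theorem encard_eq_card_label {s : Set (Incidence cell24)} {t : Finset (Fin 24 × Fin 24)}
    (h : ∀ e, e ∈ s ↔ incidenceLabel e ∈ t) (ht : ∀ p ∈ t, incident p.1 p.2 = true) :
    s.encard = t.card := by
  rw [← Set.encard_coe_eq_coe_finsetCard, ← incidenceLabel_injective.encard_image]
  congr 1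
  ext p
  constructor
  · rintro ⟨e, he, rfl⟩
    exact (h e).mp he
  · intro hp
    obtain ⟨e, he⟩ := exists_incidenceLabel_eq (ht p hp)
    exact ⟨e, (h e).mpr (he ▸ hp), he⟩

theorem encard_incidence : (Set.univ : Set (Incidence cell24)).encard = 144 := by
  rw [encard_eq_card_label (t := Finset.univ.filter fun p => incident p.1 p.2 = true)
    (fun e => by simpa [incidenceLabel] using incident_of_incidence e) (by simp), card_incident]
  rfl

theorem encard_cellRemaining : cellRemaining.encard = 140 := by
  rw [encard_eq_card_label (t := Finset.univ.filter fun p => incident p.1 p.2 = true ∧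
    ¬ deleted p.1 p.2) (fun e => ?_) (by simp +contextual), card_remaining]
  · rfl
  · rw [mem_cellRemaining]
    simpa [incidenceLabel] using fun _ => incident_of_incidence e

/-- The positions of the vertices and facets of the 24-cell. -/
noncomputable def nodePos : Node cell24 → ℕ :=
  Sum.elim (fun v => vertexPos (vertexEquiv.symm v)) fun F => facetPos (facetEquiv.symm F)

theorem isNearDegenerateOrdering_nodePos : IsNearDegenerateOrdering 4 nodePos (vertexEquiv 0)
    (vertexEquiv 8) (facetEquiv 0) (facetEquiv 8) where
  injective := by
    refine Function.Injective.sumElim (vertexPos_injective.comp vertexEquiv.symm.injective)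
      (facetPos_injective.comp facetEquiv.symm.injective) fun v F => vertexPos_ne_facetPos _ _
  edge := formEdge_vertexEquiv (by decide)
  ridge := formRidge_facetEquiv (by decide)
  mem := by
    simp only [Set.mem_inter_iff, vertexEquiv_mem_facetEquiv]
    decide
  start := by
    have hv : ∀ v, Sum.inl v ∈ ({Sum.inl (vertexEquiv 0), Sum.inl (vertexEquiv 8),
        Sum.inr (facetEquiv 0), Sum.inr (facetEquiv 8)} : Set (Node cell24)) ↔
        vertexEquiv.symm v = 0 ∨ vertexEquiv.symm v = 8 := by
      simp [Equiv.symm_apply_eq]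
    have hF : ∀ F, Sum.inr F ∈ ({Sum.inl (vertexEquiv 0), Sum.inl (vertexEquiv 8),
        Sum.inr (facetEquiv 0), Sum.inr (facetEquiv 8)} : Set (Node cell24)) ↔
        facetEquiv.symm F = 0 ∨ facetEquiv.symm F = 8 := by
      simp [Equiv.symm_apply_eq]
    intro a ha b hb
    have h1 : nodePos a ≤ 3 := by
      rcases a with v | F
      · rw [hv] at ha
        exact ((vertexPos_le (vertexEquiv.symm v)).resolve_right fun h => by tauto).2
      · rw [hF] at ha
        exact ((facetPos_le (facetEquiv.symm F)).resolve_right fun h => by tauto).2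
    have h2 : 3 < nodePos b := by
      rcases b with v | F
      · rw [hv] at hb
        exact ((vertexPos_le (vertexEquiv.symm v)).resolve_left fun h => by tauto).2
      · rw [hF] at hb
        exact ((facetPos_le (facetEquiv.symm F)).resolve_left fun h => by tauto).2
    omega
  add_facet := by
    intro H h0 h8
    obtain ⟨H, rfl⟩ := facetEquiv.surjective H
    obtain ⟨p, q, h, hp, hq, h1, h2⟩ := exists_edge_before H (fun h => h0 (h ▸ rfl))
      fun h => h8 (h ▸ rfl)
    refine ⟨_, _, formEdge_vertexEquiv h, vertexEquiv_mem_facetEquiv.mpr hp,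
      vertexEquiv_mem_facetEquiv.mpr hq, ?_, ?_⟩ <;> simpa [nodePos]
  add_vertex := by
    intro w h0 h8
    obtain ⟨w, rfl⟩ := vertexEquiv.surjective w
    obtain ⟨H, K, h, hH, hK, h1, h2⟩ := exists_ridge_before w (fun h => h0 (h ▸ rfl))
      fun h => h8 (h ▸ rfl)
    refine ⟨_, _, formRidge_facetEquiv h, vertexEquiv_mem_facetEquiv.mpr hH,
      vertexEquiv_mem_facetEquiv.mpr hK, ?_, ?_⟩ <;> simpa [nodePos]
  later_facets := by
    intro w
    -- With the vertex fixed, an incidence is determined by its facet, so it suffices to count facet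
    -- labels.
    rw [← Set.InjOn.encard_image (f := fun e => facetEquiv.symm e.facet)]
    · refine (Set.encard_le_encard ?_).trans ((Set.encard_coe_eq_coe_finsetCard _).trans_le
        (Nat.cast_le.mpr (card_later_facets (vertexEquiv.symm w))))
      rintro _ ⟨e, ⟨he, rfl, hpos⟩, rfl⟩
      simpa using ⟨incident_of_incidence e, by simpa using mem_cellRemaining.mp he, hpos⟩
    · rintro e ⟨-, he, -⟩ e' ⟨-, he', -⟩ h
      exact Incidence.ends_injective (Prod.ext (he.trans he'.symm) (facetEquiv.symm.injective h))
  later_vertices := by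
    intro H
    rw [← Set.InjOn.encard_image (f := fun e => vertexEquiv.symm e.vertex)]
    · refine (Set.encard_le_encard ?_).trans ((Set.encard_coe_eq_coe_finsetCard _).trans_le
        (Nat.cast_le.mpr (card_later_vertices (facetEquiv.symm H))))
      rintro _ ⟨e, ⟨he, rfl, hpos⟩, rfl⟩
      simpa using ⟨incident_of_incidence e, by simpa using mem_cellRemaining.mp he, hpos⟩
    · rintro e ⟨-, he, -⟩ e' ⟨-, he', -⟩ h
      exact Incidence.ends_injective (Prod.ext (vertexEquiv.symm.injective h) (he.trans he'.symm))

/-! ### Ranks of the Jacobian matrix and the dimension estimates -/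

/-- Elimination works at every realization, so only the vanishing on the four starting incidences is
left as a hypothesis. -/
theorem linearIndependent_jacobian_cell24 {x : Coord cell24 → ℝ}
    (hx : x ∈ centeredRealizationSpace cell24) (s : Set (Incidence cell24))
    (h : ∀ C : Fin 24 → Fin 24 → ℝ, (∀ v F, C v F ≠ 0 → ∃ e ∈ s, incidenceLabel e = (v, F)) →
      (∀ v, ∑ F, C v F • acol x (facetEquiv F) = 0) →
      (∀ F, ∑ v, C v F • vcol x (vertexEquiv v) = 0) →
      ∀ p ∈ [((0 : Fin 24), (0 : Fin 24)), (0, 8), (8, 0), (8, 8)], C p.1 p.2 = 0) :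
    LinearIndependent ℝ fun e : s => jacobian cell24 x e.1 := by
  rw [mem_centeredRealizationSpace_cell24_iff] at hx
  refine linearIndependent_jacobian x s fun C hC hA hV v F => ?_
  have hC' : ∀ v F, C (vertexEquiv v) (facetEquiv F) ≠ 0 → ∃ e ∈ s, incidenceLabel e = (v, F) := by
    intro v F hvF
    obtain ⟨e, he, h1, h2⟩ := hC _ _ hvF
    exact ⟨e, he, by simp [incidenceLabel, h1, h2]⟩
  have hA' : ∀ v, ∑ F, C (vertexEquiv v) (facetEquiv F) • acol x (facetEquiv F) = 0 := fun v => by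
    rw [← hA (vertexEquiv v)]
    exact facetEquiv.sum_comp fun F => C (vertexEquiv v) F • acol x F
  have hV' : ∀ F, ∑ v, C (vertexEquiv v) (facetEquiv F) • vcol x (vertexEquiv v) = 0 := fun F => by
    rw [← hV (facetEquiv F)]
    exact vertexEquiv.sum_comp fun v => C v (facetEquiv F) • vcol x v
  have := eq_zero_of_checkSteps (fun v F => (hx.incident (vertexEquiv v) (facetEquiv F)).trans
    vertexEquiv_mem_facetEquiv) (fun v F hvF => ?_) hA' hV' _ _ checkSteps_eliminationSteps
    (h _ hC' hA' hV') (vertexEquiv.symm v) (facetEquiv.symm F)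
  · simpa using this
  · obtain ⟨e, -, he⟩ := hC' v F hvF
    obtain ⟨rfl, rfl⟩ := Prod.mk.inj he
    exact incident_of_incidence e

/-- Here the stress vanishes on the starting incidences by its support. -/
theorem linearIndependent_jacobian_cellRemaining {x : Coord cell24 → ℝ}
    (hx : x ∈ centeredRealizationSpace cell24) :
    LinearIndependent ℝ fun e : cellRemaining => jacobian cell24 x e.1 := by
  refine linearIndependent_jacobian_cell24 hx _ fun C hC _ _ p hp => ?_
  by_contra hne
  obtain ⟨e, he, hep⟩ := hC _ _ hne
  rw [mem_cellRemaining] at he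
  obtain ⟨h1, h2⟩ := Prod.mk.inj hep
  rw [h1, h2] at he
  exact he ((by decide +kernel : ∀ p ∈ [((0 : Fin 24), (0 : Fin 24)), (0, 8), (8, 0), (8, 8)],
    deleted p.1 p.2 = true) p hp)

/-- A centered realization of the 24-cell. -/
noncomputable def familyPoint (c : Coord cell24) : ℝ :=
  Sum.elim (fun v => familyVertex (1 / 2) (vertexEquiv.symm v))
    (fun F => familyNormal (1 / 2) (facetEquiv.symm F)) c.1 c.2

theorem vcol_familyPoint (v : Vertex cell24) :
    vcol familyPoint v = familyVertex (1 / 2) (vertexEquiv.symm v) := rfl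

theorem acol_familyPoint (F : Facet cell24) :
    acol familyPoint F = familyNormal (1 / 2) (facetEquiv.symm F) := rfl

theorem familyPoint_mem : familyPoint ∈ centeredRealizationSpace cell24 := by
  rw [mem_centeredRealizationSpace_cell24_iff]
  exact realizes_half.comp_equiv vertexEquiv.symm facetEquiv.symm fun v F => mem_facet_iff

/-- Here all incidences may carry stress, and the four deformations give the vanishing on the
starting ones. -/
theorem linearIndependent_jacobian_familyPoint :
    LinearIndependent ℝ fun e => jacobian cell24 familyPoint e := by
  have h := linearIndependent_jacobian_cell24 familyPoint_mem Set.univ fun C hC hA hV p hp => by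
    simp only [vcol_familyPoint, acol_familyPoint, Equiv.symm_apply_apply] at hA hV
    obtain ⟨h1, h2, h3, h4⟩ := eq_zero_of_deleted (fun v F hvF => by
      obtain ⟨e, -, he⟩ := hC v F hvF
      obtain ⟨rfl, rfl⟩ := Prod.mk.inj he
      exact incident_of_incidence e) hA hV
    simp only [List.mem_cons, List.not_mem_nil, or_false] at hp
    rcases hp with rfl | rfl | rfl | rfl <;> assumption
  exact h.comp (fun e => ⟨e, Set.mem_univ e⟩) fun _ _ h => congrArg Subtype.val h

theorem card_coord : Fintype.card (Coord cell24) = 192 := by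
  rw [Fintype.card_prod, Fintype.card_sum, card_vertex, card_facet, Fintype.card_fin]

theorem eventually_mem_centeredRealizationSpace {x : Coord cell24 → ℝ}
    (hx : x ∈ centeredRealizationSpace cell24) : ∀ᶠ y in 𝓝 x,
      (∀ e, MvPolynomial.eval y (charMap cell24 e) = 0) → y ∈ centeredRealizationSpace cell24 := by
  rw [mem_centeredRealizationSpace_cell24_iff] at hx
  filter_upwards [hx.eventually (V := vcol) (A := acol)
    (fun v => (continuous_pi fun k => continuous_apply _).continuousAt)
    (fun F => (continuous_pi fun k => continuous_apply _).continuousAt)] with y hy h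
  rw [mem_centeredRealizationSpace_cell24_iff]
  refine hy fun v F hvF => ?_
  exact sub_eq_zero.mp ((eval_charMap y ⟨(v, F), hvF⟩).symm.trans (h _))

theorem eval_charMap_eq_zero {x : Coord cell24 → ℝ} (hx : x ∈ centeredRealizationSpace cell24)
    (e : Incidence cell24) : MvPolynomial.eval x (charMap cell24 e) = 0 := by
  rw [mem_centeredRealizationSpace_cell24_iff] at hx
  rw [eval_charMap]
  exact sub_eq_zero.mpr ((hx.incident _ _).mpr e.2)

noncomputable instance : Fintype (Incidence cell24) :=
  Fintype.ofInjective _ incidenceLabel_injective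

theorem card_eq_of_encard {ι : Type} [Fintype ι] {n : ℕ}
    (h : ENat.card ι = n) : Fintype.card ι = n := by
  rw [ENat.card_eq_coe_fintype_card] at h
  exact_mod_cast h

theorem le_semialgebraicDim_cell24 :
    48 ≤ semialgebraicDim (centeredRealizationSpace cell24) := by
  have h := le_semialgebraicDim_of_eventually _ (charMap cell24) familyPoint
    (eval_charMap_eq_zero familyPoint_mem) linearIndependent_jacobian_familyPoint
    (eventually_mem_centeredRealizationSpace familyPoint_mem)
  rwa [card_coord, card_eq_of_encard (n := 144) ((Set.encard_univ _).symm.trans encard_incidence)] at h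

theorem semialgebraicDim_cell24_le :
    semialgebraicDim (centeredRealizationSpace cell24) ≤ 52 := by
  have := Fintype.ofFinite cellRemaining
  have h := semialgebraicDim_le (centeredRealizationSpace cell24)
    (fun e : cellRemaining => charMap cell24 e.1) (fun x hx e => eval_charMap_eq_zero hx e.1)
    fun x hx => linearIndependent_jacobian_cellRemaining hx
  rwa [card_coord, card_eq_of_encard (n := 140) encard_cellRemaining] at h

theorem mainTheorem4 :
    -- the dimension estimates
    (48 ≤ semialgebraicDim (centeredRealizationSpace cell24) ∧
      semialgebraicDim (centeredRealizationSpace cell24) ≤ 52) ∧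
    -- the Jacobian matrix has format 144 × 192 and full rank at some centered realization
    (ENat.card (Incidence cell24) = 144 ∧ ENat.card (Coord cell24) = 192 ∧
      ∃ x ∈ centeredRealizationSpace cell24, LinearIndependent ℝ (jacobian cell24 x).row) ∧
    -- a 140 × 192 submatrix that has full rank at every centered realization
    (∃ (pos : Node cell24 → ℕ) (v u : Vertex cell24) (F G : Facet cell24),
      IsNearDegenerateOrdering 4 pos v u F G ∧
      (remaining v u F G).encard = 140 ∧
      ∀ x ∈ centeredRealizationSpace cell24, LinearIndependent ℝ
        ((jacobian cell24 x).submatrix (Subtype.val : remaining v u F G → Incidence cell24)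
          id).row) := by
  refine ⟨⟨le_semialgebraicDim_cell24, semialgebraicDim_cell24_le⟩,
    ⟨(Set.encard_univ _).symm.trans encard_incidence, ?_, familyPoint, familyPoint_mem,
      linearIndependent_jacobian_familyPoint⟩,
    nodePos, _, _, _, _, isNearDegenerateOrdering_nodePos, encard_cellRemaining, fun x hx =>
      linearIndependent_jacobian_cellRemaining hx⟩
  rw [ENat.card_eq_coe_fintype_card, card_coord]
  rfl
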